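/- An orbifold $Q$ is a Hausdorff space covered by pairwise compatible charts $\{V,G,\pi\}$: $V$ is a nonempty connected open subset of $\mathbb{R}^n$, $G$ is a finite group acting smoothly, not necessarily effectively, on $V$, and $\pi:V\to Q$ is continuous and induces a homeomorphism of $V/G$ onto an open subset of $Q$. Two charts are compatible if each point of the intersection of their images lies in the image of a chart that injects into both. An injection of charts is a smooth open embedding of the domains over $Q$, equivariant with respect to an injective homomorphism of the groups that restricts to an isomorphism of the subgroups acting trivially. An orbifold vector bundle $\rho:E\to Q$ of rank $k$ is a Hausdorff space $E$ with a continuous projection $\rho$, covered by pairwise compatible bundle charts $\{V\times\mathbb{R}^k,G,\tilde\pi\}$: here $\{V,G,\pi\}$ is a chart for $Q$, $G$ acts on $V\times\mathbb{R}^k$ by $g(x,v)=(gx,r(g,x)v)$ with $r(g,x)$ linear and smooth in $x$, and $\tilde\pi$ covers $\pi$ and induces a homeomorphism of $(V\times\mathbb{R}^k)/G$ onto $\rho^{-1}(\pi(V))$; compatibility is defined as before, by fibrewise linear injections. The bundle charts make $E$ an orbifold. The bundle $E$ is good if it is covered by bundle charts in which every element of $G$ that acts trivially on $V$ acts trivially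 on $V\times\mathbb{R}^k$; otherwise it is bad. A suborbifold embedding is a topological embedding $\iota:Q\to R$ that near each point lifts, in a chart $\{V,G,\pi\}$ for $Q$ and a chart $\{V',G',\pi'\}$ for $R$, to an injective immersion $V\to V'$ that is equivariant with respect to an isomorphism $G\cong G'$ and has image $\pi'^{-1}(\iota(Q))$. The restriction of a bundle over $R$ along $\iota$ is the part of its total space over $\iota(Q)$, regarded as a space over $Q$, with the restrictions of its bundle charts. An isomorphism of bundles over $Q$ is a homeomorphism of the total spaces over $Q$ that takes bundle charts to bundle charts. A tangent vector of the orbifold $E$ is vertical if each of its lifts to the tangent bundle of $V\times\mathbb{R}^k$, for a bundle chart $\{V\times\mathbb{R}^k,G,\tilde\pi\}$ of $E$, is tangent to the $\mathbb{R}^k$-direction; $VE\subseteq TE$ denotes the space of vertical vectors, with the bundle charts $\{(V\times\mathbb{R}^k)\times\mathbb{R}^k,G\}$ on which $G$ acts by the differential of its action on $V\times\mathbb{R}^k$. **Theorem.** Every bad orbifold vector bundle $\rho:E\to Q$ is isomorphic to the restriction, along a suborbifold embedding $Q\to R$, of a good orbifold vector bundle over an orbifold $R$. Explicitly, let $E\to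 Q$ be a bad orbifold vector bundle. Then the zero section $\iota:Q\to E$ is a suborbifold embedding of $Q$ into the orbifold $R=E$; the vertical tangent bundle $VE\to E$ is a good orbifold vector bundle of rank $k$ over the orbifold $E$; and $E$ is isomorphic, as an orbifold vector bundle over $Q$, to the restriction of $VE$ along $\iota$. -/

import Mathlib

open scoped ContDiff

/-! ### Orbifold charts -/

/-- An orbifold chart `{V, G, π}` on the topological space `X`: a finite group `G` acting smoothly,
and not necessarily effectively, on a nonempty connected open subset `V` of the model vector space
`M`, and a continuous map `π : V → X` that induces a homeomorphism from `V / G` onto an open subset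
of `X`.  The maps `act g` and `proj` are total functions whose values off `V` are irrelevant. -/
structure OrbifoldChart (M X : Type*) [NormedAddCommGroup M] [NormedSpace ℝ M]
    [TopologicalSpace X] where
  /-- the group of the chart -/
  G : Type
  [group : Group G]
  [finite : Finite G]
  /-- the domain of the chart -/
  V : Set M
  isOpen_V : IsOpen V
  isConnected_V : IsConnected V
  /-- the action of the group on the domain -/
  act : G → M → M
  act_mem : ∀ g, ∀ x ∈ V, act g x ∈ V
  act_one : ∀ x ∈ V, act 1 x = x
  act_mul : ∀ g h, ∀ x ∈ V, act (g * h) x = act g (act h x)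
  contDiffOn_act : ∀ g, ContDiffOn ℝ ∞ (act g) V
  /-- the quotient map of the chart -/
  proj : M → X
  continuousOn_proj : ContinuousOn proj V
  isOpen_image : ∀ W, W ⊆ V → IsOpen W → IsOpen (proj '' W)
  proj_eq_iff : ∀ x ∈ V, ∀ y ∈ V, (proj x = proj y ↔ ∃ g, act g x = y)

attribute [instance] OrbifoldChart.group OrbifoldChart.finite

namespace OrbifoldChart

variable {M X : Type*} [NormedAddCommGroup M] [NormedSpace ℝ M] [TopologicalSpace X]

/-- The open subset of `X` uniformized by the chart. -/
def support (c : OrbifoldChart M X) : Set X := c.proj '' c.V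

/-- The kernel of the action: the subgroup of the elements that act trivially on `V`. -/
def kernel (c : OrbifoldChart M X) : Subgroup c.G where
  carrier := {g | ∀ x ∈ c.V, c.act g x = x}
  one_mem' := c.act_one
  mul_mem' := by
    intro a b ha hb x hx
    rw [c.act_mul a b x hx, hb x hx, ha x hx]
  inv_mem' := by
    intro a ha x hx
    have h := c.act_mul a⁻¹ a x hx
    rw [inv_mul_cancel, c.act_one x hx, ha x hx] at h
    exact h.symm

/-- An injection of charts: a smooth open embedding `φ` of the domains over the identity of `X`,
equivariant with respect to an injective group homomorphism `λ` that restricts to an isomorphism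
between the kernels of the actions.  (Only the surjectivity between the kernels is required: an
element of the finite group `d.G` that acts trivially on a nonempty open subset of the connected
domain `d.V` acts trivially on `d.V`, so that `λ` maps `c.kernel` into `d.kernel` in any case.) -/
structure Injection (c d : OrbifoldChart M X) where
  /-- the embedding `φ` -/
  toFun : M → M
  /-- the homomorphism `λ` -/
  hom : c.G →* d.G
  mapsTo : ∀ x ∈ c.V, toFun x ∈ d.V
  contDiffOn : ContDiffOn ℝ ∞ toFun c.V
  injOn : Set.InjOn toFun c.V
  bijective_fderiv : ∀ x ∈ c.V, Function.Bijective (fderiv ℝ toFun x)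
  hom_injective : Function.Injective hom
  kernel_le : d.kernel ≤ c.kernel.map hom
  equivariant : ∀ g, ∀ x ∈ c.V, toFun (c.act g x) = d.act (hom g) (toFun x)
  proj_comp : ∀ x ∈ c.V, d.proj (toFun x) = c.proj x

/-- Two charts are compatible (equivalent) at `q` if some chart around `q` injects into both. -/
def CompatibleAt (c d : OrbifoldChart M X) (q : X) : Prop :=
  ∃ e : OrbifoldChart M X, q ∈ e.support ∧ Nonempty (Injection e c) ∧ Nonempty (Injection e d)

end OrbifoldChart

/-! ### Orbifolds -/

/-- An orbifold structure, not assumed to be reduced, on the topological space `X`, modelled on the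
vector space `M` (so that its dimension is that of `M`): `X` is Hausdorff and it is covered by
pairwise compatible orbifold charts. -/
structure Orbifold (M X : Type*) [NormedAddCommGroup M] [NormedSpace ℝ M]
    [TopologicalSpace X] where
  t2 : T2Space X
  /-- the charts of the structure -/
  atlas : Set (OrbifoldChart M X)
  cover : ∀ q, ∃ c ∈ atlas, q ∈ c.support
  compatible : ∀ c ∈ atlas, ∀ d ∈ atlas, ∀ q, q ∈ c.support → q ∈ d.support → c.CompatibleAt d q

/-- A chart for the orbifold `Q`: a chart that is compatible with the charts of the atlas. -/
def Orbifold.IsChart {M X : Type*} [NormedAddCommGroup M] [NormedSpace ℝ M] [TopologicalSpace X]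
    (Q : Orbifold M X) (c : OrbifoldChart M X) : Prop :=
  ∀ d ∈ Q.atlas, ∀ q, q ∈ c.support → q ∈ d.support → c.CompatibleAt d q

/-! ### Charts of orbifold vector bundles -/

/-- A chart `{V × F, G, Π}` of an orbifold vector bundle `ρ : T → X` over the chart `c = {V, G, π}`
of the base: `G` acts on `V × F` by `g (x, v) = (g x, r(g, x) v)` with `r(g, x)` linear in `v` and
smooth in `x`, and `Π : V × F → T` covers `π` and induces a homeomorphism from `(V × F) / G` onto
the open subset of `T` over the support of `c`. -/
structure OrbifoldBundleChart {M X T : Type*} (F : Type*) [NormedAddCommGroup M] [NormedSpace ℝ M]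
    [NormedAddCommGroup F] [NormedSpace ℝ F] [TopologicalSpace X] [TopologicalSpace T]
    (ρ : T → X) (c : OrbifoldChart M X) where
  /-- the linear parts `r(g, x)` of the action of the group -/
  lin : c.G → M → F →L[ℝ] F
  contDiffOn_lin : ∀ g, ContDiffOn ℝ ∞ (lin g) c.V
  lin_one : ∀ x ∈ c.V, lin 1 x = ContinuousLinearMap.id ℝ F
  lin_mul : ∀ g h, ∀ x ∈ c.V, lin (g * h) x = (lin g (c.act h x)).comp (lin h x)
  /-- the quotient map `Π` -/
  proj : M × F → T
  continuousOn_proj : ContinuousOn proj (c.V ×ˢ Set.univ)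
  isOpen_image : ∀ W, W ⊆ c.V ×ˢ Set.univ → IsOpen W → IsOpen (proj '' W)
  proj_eq_iff : ∀ x ∈ c.V, ∀ v, ∀ y ∈ c.V, ∀ w,
    (proj (x, v) = proj (y, w) ↔ ∃ g, c.act g x = y ∧ lin g x v = w)
  base_proj : ∀ x ∈ c.V, ∀ v, ρ (proj (x, v)) = c.proj x
  exists_proj : ∀ t, ρ t ∈ c.support → ∃ x ∈ c.V, ∃ v, proj (x, v) = t

namespace OrbifoldBundleChart

variable {M X T F : Type*} [NormedAddCommGroup M] [NormedSpace ℝ M]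
  [NormedAddCommGroup F] [NormedSpace ℝ F] [TopologicalSpace X] [TopologicalSpace T]
  {ρ : T → X} {c d : OrbifoldChart M X}

/-- The bundle chart `{V × F, G, Π}` as an orbifold chart on the total space. -/
def total (C : OrbifoldBundleChart F ρ c) : OrbifoldChart (M × F) T where
  G := c.G
  V := c.V ×ˢ Set.univ
  isOpen_V := c.isOpen_V.prod isOpen_univ
  isConnected_V := c.isConnected_V.prod isConnected_univ
  act g p := (c.act g p.1, C.lin g p.1 p.2)
  act_mem g p hp := ⟨c.act_mem g p.1 hp.1, Set.mem_univ _⟩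
  act_one p hp := by
    ext1
    · exact c.act_one p.1 hp.1
    · simp [C.lin_one p.1 hp.1]
  act_mul g h p hp := by
    ext1
    · exact c.act_mul g h p.1 hp.1
    · simp [C.lin_mul g h p.1 hp.1]
  contDiffOn_act g := by
    have hm : Set.MapsTo Prod.fst (c.V ×ˢ (Set.univ : Set F)) c.V := fun p hp => hp.1
    exact ((c.contDiffOn_act g).comp contDiffOn_fst hm).prodMk
      (((C.contDiffOn_lin g).comp contDiffOn_fst hm).clm_apply contDiffOn_snd)
  proj := C.proj
  continuousOn_proj := C.continuousOn_proj
  isOpen_image := C.isOpen_image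
  proj_eq_iff := by
    rintro ⟨x, v⟩ hx ⟨y, w⟩ hy
    simpa [Prod.ext_iff] using C.proj_eq_iff x hx.1 v y hy.1 w

/-- The transport of a bundle chart along a homeomorphism of total spaces over the base. -/
def push {T' : Type*} [TopologicalSpace T'] {ρ' : T' → X} (C : OrbifoldBundleChart F ρ c)
    (Φ : T ≃ₜ T') (hΦ : ∀ t, ρ' (Φ t) = ρ t) : OrbifoldBundleChart F ρ' c where
  lin := C.lin
  contDiffOn_lin := C.contDiffOn_lin
  lin_one := C.lin_one
  lin_mul := C.lin_mul
  proj p := Φ (C.proj p)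
  continuousOn_proj := Φ.continuous.comp_continuousOn C.continuousOn_proj
  isOpen_image W hW hWo := by
    have h := Φ.isOpenMap _ (C.isOpen_image W hW hWo)
    rwa [Set.image_image] at h
  proj_eq_iff x hx v y hy w := by
    rw [Φ.injective.eq_iff]
    exact C.proj_eq_iff x hx v y hy w
  base_proj x hx v := by
    rw [hΦ]
    exact C.base_proj x hx v
  exists_proj t ht := by
    have h : ρ (Φ.symm t) ∈ c.support := by
      rw [← hΦ, Φ.apply_symm_apply]
      exact ht
    obtain ⟨x, hx, v, hv⟩ := C.exists_proj _ h
    exact ⟨x, hx, v, by rw [hv, Φ.apply_symm_apply]⟩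

/-- An injection of bundle charts: an injection `(φ, λ)` of the charts of the base together with a
`λ`-equivariant embedding `(x, v) ↦ (φ x, A(x) v)`, over the identity of the total space, whose
transition map `A` is smooth with values in the linear automorphisms of `F`. -/
structure Injection (C : OrbifoldBundleChart F ρ c) (D : OrbifoldBundleChart F ρ d) where
  /-- the injection `(φ, λ)` of the charts of the base -/
  base : OrbifoldChart.Injection c d
  /-- the transition map `A` -/
  lin : M → F →L[ℝ] F
  contDiffOn_lin : ContDiffOn ℝ ∞ lin c.V
  bijective_lin : ∀ x ∈ c.V, Function.Bijective (lin x)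
  equivariant : ∀ g, ∀ x ∈ c.V,
    (lin (c.act g x)).comp (C.lin g x) = (D.lin (base.hom g) (base.toFun x)).comp (lin x)
  proj_comp : ∀ x ∈ c.V, ∀ v, D.proj (base.toFun x, lin x v) = C.proj (x, v)

/-- Two bundle charts are compatible (isomorphic near `q`) if some bundle chart around `q` injects
into both. -/
def CompatibleAt (C : OrbifoldBundleChart F ρ c) (D : OrbifoldBundleChart F ρ d) (q : X) : Prop :=
  ∃ (e : OrbifoldChart M X) (B : OrbifoldBundleChart F ρ e), q ∈ e.support ∧
    Nonempty (Injection B C) ∧ Nonempty (Injection B D)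

/-- An injection of bundle charts is an injection of orbifold charts on the total space. -/
def Injection.total {C : OrbifoldBundleChart F ρ c} {D : OrbifoldBundleChart F ρ d}
    (i : Injection C D) : OrbifoldChart.Injection C.total D.total where
  toFun p := (i.base.toFun p.1, i.lin p.1 p.2)
  hom := i.base.hom
  mapsTo p hp := ⟨i.base.mapsTo p.1 hp.1, Set.mem_univ _⟩
  contDiffOn := by
    have hm : Set.MapsTo Prod.fst (c.V ×ˢ (Set.univ : Set F)) c.V := fun p hp => hp.1
    exact (i.base.contDiffOn.comp contDiffOn_fst hm).prodMk
      ((i.contDiffOn_lin.comp contDiffOn_fst hm).clm_apply contDiffOn_snd)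
  injOn := by
    rintro ⟨x, v⟩ hx ⟨y, w⟩ hy h
    simp only [Prod.mk.injEq] at h
    obtain rfl := i.base.injOn hx.1 hy.1 h.1
    rw [(i.bijective_lin x hx.1).1 h.2]
  bijective_fderiv := by
    rintro ⟨x, v⟩ hx
    have hx1 : x ∈ c.V := hx.1
    have h1 : HasFDerivAt i.base.toFun (fderiv ℝ i.base.toFun x) x :=
      ((i.base.contDiffOn.differentiableOn (by simp)).differentiableAt
        (c.isOpen_V.mem_nhds hx1)).hasFDerivAt
    have h2 : HasFDerivAt i.lin (fderiv ℝ i.lin x) x :=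
      ((i.contDiffOn_lin.differentiableOn (by simp)).differentiableAt
        (c.isOpen_V.mem_nhds hx1)).hasFDerivAt
    have hf : HasFDerivAt (Prod.fst : M × F → M) (ContinuousLinearMap.fst ℝ M F) (x, v) :=
      hasFDerivAt_fst
    have hs : HasFDerivAt (Prod.snd : M × F → F) (ContinuousLinearMap.snd ℝ M F) (x, v) :=
      hasFDerivAt_snd
    have h3 := (HasFDerivAt.comp (x, v) h1 hf).prodMk ((HasFDerivAt.comp (x, v) h2 hf).clm_apply hs)
    have h4 := h3.fderiv
    have key : ∀ p : M × F,
        fderiv ℝ (fun p : M × F => (i.base.toFun p.1, i.lin p.1 p.2)) (x, v) p =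
          (fderiv ℝ i.base.toFun x p.1, i.lin x p.2 + fderiv ℝ i.lin x p.1 v) := by
      intro p
      refine (congrArg (fun L : M × F →L[ℝ] M × F => L p) h4).trans ?_
      simp
    obtain ⟨bi, bs⟩ := i.base.bijective_fderiv x hx1
    obtain ⟨li, ls⟩ := i.bijective_lin x hx1
    constructor
    · rw [injective_iff_map_eq_zero]
      rintro ⟨a, b⟩ hab
      rw [key, Prod.mk_eq_zero] at hab
      have ha : a = 0 := bi (by simpa using hab.1)
      subst ha
      have hb : b = 0 := li (by simpa using hab.2)
      rw [hb]
      rfl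
    · rintro ⟨a, b⟩
      obtain ⟨a', ha'⟩ := bs a
      obtain ⟨b', hb'⟩ := ls (b - fderiv ℝ i.lin x a' v)
      refine ⟨(a', b'), ?_⟩
      rw [key]
      simp [ha', hb']
  hom_injective := i.base.hom_injective
  kernel_le := by
    have eqv : ∀ (g : c.G) (x : M) (hx : x ∈ c.V) (v : F),
        i.lin (c.act g x) (C.lin g x v) =
          D.lin (i.base.hom g) (i.base.toFun x) (i.lin x v) := by
      intro g x hx v
      exact congrArg (fun L : F →L[ℝ] F => L v) (i.equivariant g x hx)
    intro h hh
    have hhb : h ∈ d.kernel := fun y hy => congrArg Prod.fst (hh (y, 0) ⟨hy, Set.mem_univ _⟩)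
    obtain ⟨g, hg, rfl⟩ := i.base.kernel_le hhb
    refine ⟨g, ?_, rfl⟩
    rintro ⟨x, v⟩ hx
    have e := eqv g x hx.1 v
    have hact : c.act g x = x := hg x hx.1
    have hD : D.lin (i.base.hom g) (i.base.toFun x) (i.lin x v) = i.lin x v :=
      congrArg Prod.snd (hh (i.base.toFun x, i.lin x v) ⟨i.base.mapsTo x hx.1, Set.mem_univ _⟩)
    rw [hact, hD] at e
    exact Prod.ext hact ((i.bijective_lin x hx.1).1 e)
  equivariant := by
    rintro g ⟨x, v⟩ hx
    exact Prod.ext (i.base.equivariant g x hx.1)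
      (congrArg (fun L : F →L[ℝ] F => L v) (i.equivariant g x hx.1))
  proj_comp := by
    rintro ⟨x, v⟩ hx
    exact i.proj_comp x hx.1 v

end OrbifoldBundleChart

/-! ### Orbifold vector bundles -/

/-- An orbifold vector bundle with total space `T` and typical fibre `F` (so that its rank is the
dimension of `F`) over the orbifold `Q`: a Hausdorff space with a continuous projection to `X` that
is covered by pairwise compatible bundle charts over charts for `Q`. -/
structure OrbifoldVectorBundle {M X : Type*} [NormedAddCommGroup M] [NormedSpace ℝ M]
    [TopologicalSpace X] (Q : Orbifold M X) (F T : Type*) [NormedAddCommGroup F]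
    [NormedSpace ℝ F] [TopologicalSpace T] where
  t2 : T2Space T
  /-- the projection of the bundle -/
  proj : T → X
  continuous_proj : Continuous proj
  /-- the bundle charts of the structure, over each chart of the base -/
  atlas : (c : OrbifoldChart M X) → Set (OrbifoldBundleChart F proj c)
  isChart_base : ∀ c, ∀ C ∈ atlas c, Q.IsChart c
  cover : ∀ q, ∃ c, ∃ C ∈ atlas c, q ∈ c.support
  compatible : ∀ c, ∀ C ∈ atlas c, ∀ d, ∀ D ∈ atlas d, ∀ q, q ∈ c.support → q ∈ d.support →
    C.CompatibleAt D q

namespace OrbifoldVectorBundle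

variable {M X F T : Type*} [NormedAddCommGroup M] [NormedSpace ℝ M] [TopologicalSpace X]
  [NormedAddCommGroup F] [NormedSpace ℝ F] [TopologicalSpace T] {Q : Orbifold M X}

/-- A bundle chart for `E`: a bundle chart over a chart for `Q` that is compatible with the bundle
charts of the atlas. -/
def IsChart (E : OrbifoldVectorBundle Q F T) {c : OrbifoldChart M X}
    (C : OrbifoldBundleChart F E.proj c) : Prop :=
  Q.IsChart c ∧ ∀ d, ∀ D ∈ E.atlas d, ∀ q, q ∈ c.support → q ∈ d.support → C.CompatibleAt D q

/-- `E` is good if it is covered by bundle charts for which the kernel of the action on `V × F`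
coincides with the kernel of the action on `V`. -/
def IsGood (E : OrbifoldVectorBundle Q F T) : Prop :=
  ∀ q, ∃ (c : OrbifoldChart M X) (C : OrbifoldBundleChart F E.proj c),
    E.IsChart C ∧ q ∈ c.support ∧ ∀ g : c.G, g ∈ C.total.kernel ↔ g ∈ c.kernel

/-- `E` is bad if it is not good. -/
def IsBad (E : OrbifoldVectorBundle Q F T) : Prop := ¬ E.IsGood

/-- The orbifold structure of the total space, with the bundle charts as orbifold charts. -/
def total (E : OrbifoldVectorBundle Q F T) : Orbifold (M × F) T where
  t2 := E.t2
  atlas := {t | ∃ c, ∃ C ∈ E.atlas c, C.total = t}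
  cover t := by
    obtain ⟨c, C, hC, hq⟩ := E.cover (E.proj t)
    obtain ⟨x, hx, v, hv⟩ := C.exists_proj t hq
    exact ⟨C.total, ⟨c, C, hC, rfl⟩, (x, v), ⟨hx, Set.mem_univ _⟩, hv⟩
  compatible := by
    rintro _ ⟨c, C, hC, rfl⟩ _ ⟨d, D, hD, rfl⟩ t ⟨⟨x, v⟩, hx, rfl⟩ ⟨⟨y, w⟩, hy, hyx⟩
    have hc : E.proj (C.total.proj (x, v)) ∈ c.support :=
      ⟨x, hx.1, (C.base_proj x hx.1 v).symm⟩
    have hd : E.proj (C.total.proj (x, v)) ∈ d.support := by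
      rw [← hyx]
      exact ⟨y, hy.1, (D.base_proj y hy.1 w).symm⟩
    obtain ⟨e, B, he, ⟨i⟩, ⟨j⟩⟩ := E.compatible c C hC d D hD _ hc hd
    obtain ⟨z, hz, u, hu⟩ := B.exists_proj _ he
    exact ⟨B.total, ⟨(z, u), ⟨hz, Set.mem_univ _⟩, hu⟩, ⟨i.total⟩, ⟨j.total⟩⟩

/-- An isomorphism of orbifold vector bundles over the identity of the base: a homeomorphism of the
total spaces over the base that takes bundle charts to bundle charts. -/
structure Iso {T' : Type*} [TopologicalSpace T'] (E : OrbifoldVectorBundle Q F T)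
    (E' : OrbifoldVectorBundle Q F T') where
  /-- the homeomorphism of the total spaces -/
  toHomeomorph : T ≃ₜ T'
  proj_comp : ∀ t, E'.proj (toHomeomorph t) = E.proj t
  isChart_push : ∀ c, ∀ C ∈ E.atlas c, E'.IsChart (C.push toHomeomorph proj_comp)

/-- The point `0` of the fibre over `q`. -/
theorem exists_zero (E : OrbifoldVectorBundle Q F T) (q : X) :
    ∃ t, ∃ c, ∃ C ∈ E.atlas c, ∃ x ∈ c.V, c.proj x = q ∧ C.proj (x, 0) = t := by
  obtain ⟨c, C, hC, x, hx, rfl⟩ := E.cover q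
  exact ⟨_, c, C, hC, x, hx, rfl, rfl⟩

/-- The zero section `ι : Q → E`. -/
noncomputable def zeroSection (E : OrbifoldVectorBundle Q F T) (q : X) : T :=
  (E.exists_zero q).choose

/-- In each bundle chart of the atlas the zero section is `x ↦ (x, 0)`. -/
theorem zeroSection_proj (E : OrbifoldVectorBundle Q F T) (c : OrbifoldChart M X)
    (C : OrbifoldBundleChart F E.proj c) (hC : C ∈ E.atlas c) (x : M) (hx : x ∈ c.V) :
    E.zeroSection (c.proj x) = C.proj (x, 0) := by
  obtain ⟨d, D, hD, y, hy, hyx, h⟩ := (E.exists_zero (c.proj x)).choose_spec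
  refine h.symm.trans ?_
  obtain ⟨e, B, ⟨z, hz, hzx⟩, ⟨i⟩, ⟨j⟩⟩ :=
    E.compatible c C hC d D hD (c.proj x) ⟨x, hx, rfl⟩ ⟨y, hy, hyx⟩
  have key : ∀ (d : OrbifoldChart M X) (D : OrbifoldBundleChart F E.proj d)
      (j : OrbifoldBundleChart.Injection B D) (y : M), y ∈ d.V → d.proj y = e.proj z →
      D.proj (y, 0) = B.proj (z, 0) := by
    intro d D j y hy hyz
    rw [← j.proj_comp z hz 0, map_zero]
    rw [← j.base.proj_comp z hz] at hyz
    obtain ⟨g, hg⟩ := (d.proj_eq_iff y hy _ (j.base.mapsTo z hz)).1 hyz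
    exact (D.proj_eq_iff y hy 0 _ (j.base.mapsTo z hz) 0).2 ⟨g, hg, map_zero _⟩
  rw [key d D j y hy (hyx.trans hzx.symm), key c C i x hx hzx.symm]

end OrbifoldVectorBundle

/-! ### Suborbifolds and restrictions of bundles -/

/-- The local form of a suborbifold embedding `ι`: in the chart `d` of the larger orbifold, with the
same group up to isomorphism, the domain of the chart `c` is an invariant submanifold of the domain
of `d`, namely the preimage of the image of `ι`. -/
structure SuborbifoldChart {M N X Y : Type*} [NormedAddCommGroup M] [NormedSpace ℝ M]
    [NormedAddCommGroup N] [NormedSpace ℝ N] [TopologicalSpace X] [TopologicalSpace Y]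
    (ι : X → Y) (c : OrbifoldChart M X) (d : OrbifoldChart N Y) where
  /-- the embedding of the domains -/
  toFun : M → N
  /-- the isomorphism of the groups -/
  hom : c.G ≃* d.G
  mapsTo : ∀ x ∈ c.V, toFun x ∈ d.V
  contDiffOn : ContDiffOn ℝ ∞ toFun c.V
  injOn : Set.InjOn toFun c.V
  injective_fderiv : ∀ x ∈ c.V, Function.Injective (fderiv ℝ toFun x)
  equivariant : ∀ g, ∀ x ∈ c.V, toFun (c.act g x) = d.act (hom g) (toFun x)
  proj_comp : ∀ x ∈ c.V, d.proj (toFun x) = ι (c.proj x)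
  mem_image : ∀ y ∈ d.V, d.proj y ∈ Set.range ι → y ∈ toFun '' c.V

/-- `ι` is an embedding of `Q` as a suborbifold of `R`. -/
def Orbifold.IsSuborbifoldEmbedding {M N X Y : Type*} [NormedAddCommGroup M] [NormedSpace ℝ M]
    [NormedAddCommGroup N] [NormedSpace ℝ N] [TopologicalSpace X] [TopologicalSpace Y]
    (Q : Orbifold M X) (R : Orbifold N Y) (ι : X → Y) : Prop :=
  Topology.IsEmbedding ι ∧ ∀ q, ∃ (c : OrbifoldChart M X) (d : OrbifoldChart N Y),
    Q.IsChart c ∧ R.IsChart d ∧ q ∈ c.support ∧ Nonempty (SuborbifoldChart ι c d)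

/-- The total space of the restriction along `ι` of a bundle with projection `ρ`. -/
abbrev RestrictionSpace {X Y S : Type*} (ι : X → Y) (ρ : S → Y) : Type _ :=
  {p : X × S // ι p.1 = ρ p.2}

/-- The bundle `B` over `Q` is the restriction along `ι : Q → R` of the bundle `E` over `R`: it
lives on the restriction of the total space of `E`, and its bundle charts are the restrictions
of bundle charts for `E` over suborbifold charts. -/
def OrbifoldVectorBundle.IsRestriction {M N X Y F S : Type*}
    [NormedAddCommGroup M] [NormedSpace ℝ M] [NormedAddCommGroup N] [NormedSpace ℝ N]
    [NormedAddCommGroup F] [NormedSpace ℝ F]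
    [TopologicalSpace X] [TopologicalSpace Y] [TopologicalSpace S]
    {Q : Orbifold M X} {R : Orbifold N Y} (ι : X → Y) (E : OrbifoldVectorBundle R F S)
    (B : OrbifoldVectorBundle Q F (RestrictionSpace ι E.proj)) : Prop :=
  (∀ p, B.proj p = p.1.1) ∧
  ∀ c, ∀ C ∈ B.atlas c, ∃ (d : OrbifoldChart N Y) (D : OrbifoldBundleChart F E.proj d)
    (j : SuborbifoldChart ι c d), E.IsChart D ∧
      (∀ g, ∀ x ∈ c.V, C.lin g x = D.lin (j.hom g) (j.toFun x)) ∧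
      ∀ x ∈ c.V, ∀ v, (C.proj (x, v)).1.2 = D.proj (j.toFun x, v)

/-! ### The tangent bundle and the vertical tangent bundle -/

namespace Orbifold

variable {M X : Type*} [NormedAddCommGroup M] [NormedSpace ℝ M] [TopologicalSpace X]

/-- The disjoint union of the tangent bundles `TV = V × M` of the domains of the charts. -/
abbrev PreTangent (Q : Orbifold M X) : Type _ := (c : Q.atlas) × (c.1.V × M)

/-- Two tangent vectors in charts are identified if they are the images of one tangent vector in a
chart `e` under the differentials of injections of `e`. -/
def TangentRel (Q : Orbifold M X) (a b : Q.PreTangent) : Prop :=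
  ∃ (e : OrbifoldChart M X) (i : OrbifoldChart.Injection e a.1.1)
    (j : OrbifoldChart.Injection e b.1.1), ∃ z ∈ e.V, ∃ Z : M,
      i.toFun z = a.2.1 ∧ fderiv ℝ i.toFun z Z = a.2.2 ∧
      j.toFun z = b.2.1 ∧ fderiv ℝ j.toFun z Z = b.2.2

/-- The total space of the tangent bundle `TQ`, with the quotient topology. -/
def Tangent (Q : Orbifold M X) : Type _ := Quot Q.TangentRel

instance (Q : Orbifold M X) : TopologicalSpace Q.Tangent :=
  inferInstanceAs (TopologicalSpace (Quot Q.TangentRel))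

/-- The tangent vector of `Q` with the lift `u` at the point `x` of the chart `c`. -/
def Tangent.mk {Q : Orbifold M X} (c : Q.atlas) (x : c.1.V) (u : M) : Q.Tangent :=
  Quot.mk _ ⟨c, x, u⟩

/-- The projection `TQ → Q`. -/
def tangentProj (Q : Orbifold M X) : Q.Tangent → X :=
  Quot.lift (fun a => a.1.1.proj a.2.1) (by
    rintro a b ⟨e, i, j, z, hz, Z, hi, -, hj, -⟩
    rw [← hi, ← hj, i.proj_comp z hz, j.proj_comp z hz])

end Orbifold

namespace OrbifoldVectorBundle

variable {M X F T : Type*} [NormedAddCommGroup M] [NormedSpace ℝ M] [TopologicalSpace X]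
  [NormedAddCommGroup F] [NormedSpace ℝ F] [TopologicalSpace T] {Q : Orbifold M X}

/-- The tangent vector of `E` with the lift `u` at the point `(x, v)` of the bundle chart `C`. -/
noncomputable def tangentMk (E : OrbifoldVectorBundle Q F T) {c : OrbifoldChart M X}
    {C : OrbifoldBundleChart F E.proj c} (hC : C ∈ E.atlas c) {x : M} (hx : x ∈ c.V) (v : F)
    (u : M × F) : E.total.Tangent :=
  Orbifold.Tangent.mk ⟨C.total, c, C, hC, rfl⟩ ⟨(x, v), hx, Set.mem_univ _⟩ u

/-- A tangent vector of `E` is vertical if each of its lifts to the tangent bundle of `V × F`, for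
a bundle chart `{V × F, G, Π}`, is vertical, that is, has no component along `V`. -/
def IsVertical (E : OrbifoldVectorBundle Q F T) (ξ : E.total.Tangent) : Prop :=
  ∀ (c : OrbifoldChart M X) (C : OrbifoldBundleChart F E.proj c) (hC : C ∈ E.atlas c)
    (x : M) (hx : x ∈ c.V) (v : F) (u : M × F), E.tangentMk hC hx v u = ξ → u.1 = 0

/-- The total space of the vertical tangent bundle `VE`, as a subspace of `TE`. -/
abbrev Vertical (E : OrbifoldVectorBundle Q F T) : Type _ :=
  {ξ : E.total.Tangent // E.IsVertical ξ}

/-- The bundle `VE` over the orbifold `E` is the vertical tangent bundle: its total space is the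
space of vertical vectors, its projection is that of `TE`, and each bundle chart `{V × F, G, Π}` of
`E` induces the bundle chart of `VE` that takes `((x, v), w)` to the tangent vector `(0, w)` at
`(x, v)`, the group acting by the differential of its action on `V × F`. -/
def IsVerticalTangentBundle (E : OrbifoldVectorBundle Q F T)
    (VE : OrbifoldVectorBundle E.total F E.Vertical) : Prop :=
  (∀ ξ, VE.proj ξ = E.total.tangentProj ξ.1) ∧
  ∀ (c : OrbifoldChart M X) (C : OrbifoldBundleChart F E.proj c) (hC : C ∈ E.atlas c),
    ∃ D ∈ VE.atlas C.total, ∀ (x : M) (hx : x ∈ c.V) (v : F),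
      (∀ w, (D.proj ((x, v), w)).1 = E.tangentMk hC hx v (0, w)) ∧
      ∀ (g : c.G) (w : F), ((0, D.lin g (x, v) w) : M × F) = fderiv ℝ (C.total.act g) (x, v) (0, w)

end OrbifoldVectorBundle

/-! In a bundle chart the group acts by `g (x, v) = (g x, r(g, x) v)`, and the differential at `(x,
v)` sends a vertical vector `(0, w)` to `(0, r(g, x) w)`. So `VE` has charts `(V × F) × F` whose
linear parts do not depend on `v`. If `g` fixes every point of `V × F`, then every `r(g, x)` is the
identity, and `g` fixes `(V × F) × F`: `VE` is good. Putting `v = 0` leaves the action `(x, w) ↦ (g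
x, r(g, x) w)`, which is that of `E`.

The work lies in making `VE` a bundle, because `TE` is a quotient by a generated equivalence
relation and equality in it must be made explicit. Injections are replaced by `C¹` germs over the
base space (`GermRel`), which compose. By a Baire category argument, `exists_act_eq_fderiv_comp_eq`,
such a germ from a chart to itself agrees with a group element at the base point to first order.
Hence two lifts in one chart, or in a chart injecting into it, represent one tangent vector iff a
group element relates them (`tangentMk_injection_eq_iff`).

Transition maps of `E` are fibrewise linear, so they preserve vertical vectors and act on them by
the same linear maps as on the fibres. This gives the charts of `VE` (`verticalChart`) and their
compatibility (`verticalInjection`). It also makes `verticalLift`, which sends a point of a fibre to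
the corresponding vertical vector at zero, well defined. Paired with the projection of `E`, it is a
homeomorphism onto the restriction of `VE`. -/

open Filter Topology

/-! ### Self-injections of charts and first-order germs over the quotient. -/

namespace OrbifoldChart

variable {M X : Type*} [NormedAddCommGroup M] [NormedSpace ℝ M] [TopologicalSpace X]

theorem act_inv_act (c : OrbifoldChart M X) (g : c.G) {x : M} (hx : x ∈ c.V) :
    c.act g⁻¹ (c.act g x) = x := by
  rw [← c.act_mul _ _ x hx, inv_mul_cancel, c.act_one x hx]

theorem proj_act (c : OrbifoldChart M X) (g : c.G) {x : M} (hx : x ∈ c.V) :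
    c.proj (c.act g x) = c.proj x :=
  ((c.proj_eq_iff x hx _ (c.act_mem g x hx)).2 ⟨g, rfl⟩).symm

theorem contDiffAt_act (c : OrbifoldChart M X) (g : c.G) {x : M} (hx : x ∈ c.V) :
    ContDiffAt ℝ 1 (c.act g) x :=
  ((c.contDiffOn_act g).contDiffAt (c.isOpen_V.mem_nhds hx)).of_le (by simp)

theorem fderiv_act_inv_comp (c : OrbifoldChart M X) (g : c.G) {x : M} (hx : x ∈ c.V) :
    (fderiv ℝ (c.act g⁻¹) (c.act g x)).comp (fderiv ℝ (c.act g) x) =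
      ContinuousLinearMap.id ℝ M := by
  have h1 := (c.contDiffAt_act g hx).differentiableAt (by simp)
  have h2 := (c.contDiffAt_act g⁻¹ (c.act_mem g x hx)).differentiableAt (by simp)
  rw [← fderiv_comp x h2 h1, ← fderiv_id (𝕜 := ℝ) (x := x)]
  refine EventuallyEq.fderiv_eq ?_
  filter_upwards [c.isOpen_V.mem_nhds hx] with z hz
  exact c.act_inv_act g hz

namespace Injection

variable {c d : OrbifoldChart M X}

theorem contDiffAt (i : Injection c d) {x : M} (hx : x ∈ c.V) : ContDiffAt ℝ ∞ i.toFun x :=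
  i.contDiffOn.contDiffAt (c.isOpen_V.mem_nhds hx)

theorem contDiffAt_one (i : Injection c d) {x : M} (hx : x ∈ c.V) : ContDiffAt ℝ 1 i.toFun x :=
  (i.contDiffAt hx).of_le (by simp)

/-- The identity injection. -/
def refl (c : OrbifoldChart M X) : Injection c c where
  toFun := id
  hom := MonoidHom.id _
  mapsTo _ h := h
  contDiffOn := contDiffOn_id
  injOn := Set.injOn_id _
  bijective_fderiv x _ := by
    rw [fderiv_id]
    exact Function.bijective_id
  hom_injective := Function.injective_id
  kernel_le := by simp
  equivariant _ _ _ := rfl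
  proj_comp _ _ := rfl

/-- The injection of a chart into itself given by an element of its group. -/
def ofAct (c : OrbifoldChart M X) (g : c.G) : Injection c c where
  toFun := c.act g
  hom := (MulAut.conj g).toMonoidHom
  mapsTo := c.act_mem g
  contDiffOn := c.contDiffOn_act g
  injOn x hx y hy h := by
    rw [← c.act_inv_act g hx, ← c.act_inv_act g hy]
    exact congrArg _ h
  bijective_fderiv x hx := by
    have h1 := c.fderiv_act_inv_comp g hx
    have h2 := c.fderiv_act_inv_comp g⁻¹ (c.act_mem g x hx)
    rw [inv_inv, c.act_inv_act g hx] at h2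
    exact Function.bijective_iff_has_inverse.2 ⟨_, fun u => DFunLike.congr_fun h1 u,
      fun u => DFunLike.congr_fun h2 u⟩
  hom_injective := (MulAut.conj g).injective
  kernel_le h hh := by
    refine ⟨g⁻¹ * h * g, fun x hx => ?_, ?_⟩
    · rw [c.act_mul _ _ x hx, c.act_mul _ _ _ (c.act_mem g x hx), hh _ (c.act_mem g x hx),
        c.act_inv_act g hx]
    · simp [mul_assoc]
  equivariant h x hx := by
    change _ = c.act (g * h * g⁻¹) _
    rw [← c.act_mul _ _ x hx, ← c.act_mul _ _ x hx, inv_mul_cancel_right]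
  proj_comp _ hx := c.proj_act g hx

end Injection

/-- Two `C¹` germs of maps into the domain of a chart that agree in the quotient differ at the base
point, together with their differentials, by an element of the group. -/
theorem exists_act_eq_fderiv_comp_eq [CompleteSpace M] (c : OrbifoldChart M X) {φ ψ : M → M} {x : M}
    (hφ : ContDiffAt ℝ 1 φ x) (hψ : ContDiffAt ℝ 1 ψ x)
    (h : ∀ᶠ z in 𝓝 x, φ z ∈ c.V ∧ ψ z ∈ c.V ∧ c.proj (φ z) = c.proj (ψ z)) :
    ∃ g, c.act g (φ x) = ψ x ∧
      (fderiv ℝ (c.act g) (φ x)).comp (fderiv ℝ φ x) = fderiv ℝ ψ x := by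
  obtain ⟨U, hU, hUo, hxU⟩ := eventually_nhds_iff.1
    (((hφ.eventually (by simp)).and (hψ.eventually (by simp))).and h)
  have hcomp : ∀ g, ∀ z ∈ U, ContDiffAt ℝ 1 (c.act g ∘ φ) z := fun g z hz =>
    (c.contDiffAt_act g (hU z hz).2.1).comp z (hU z hz).1.1
  have cont : ∀ f : M → M, (∀ z ∈ U, ContDiffAt ℝ 1 f z) →
      Continuous (fun z : U => f z) ∧ Continuous (fun z : U => fderiv ℝ f z) := by
    intro f hf
    have h1 : ContDiffOn ℝ 1 f U := fun z hz => (hf z hz).contDiffWithinAt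
    exact ⟨continuousOn_iff_continuous_domRestrict.1 h1.continuousOn,
      continuousOn_iff_continuous_domRestrict.1 (h1.continuousOn_fderiv_of_isOpen hUo le_rfl)⟩
  have cψ := cont ψ fun z hz => (hU z hz).1.2
  -- Choosing `g` at the point `x` alone would not control the differential, since `φ x` may have a
  -- nontrivial stabilizer. The finitely many closed sets `S g` cover `U`, so by Baire their
  -- interiors have dense union.
  let S : c.G → Set U := fun g => {z | (c.act g ∘ φ) z = ψ z}
  have hS : ∀ g, IsClosed (S g) := fun g => isClosed_eq (cont _ (hcomp g)).1 cψ.1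
  have hcov : ⋃ g, S g = Set.univ := by
    refine Set.eq_univ_of_forall fun z => Set.mem_iUnion.2 ?_
    obtain ⟨-, h1, h2, h3⟩ := hU z z.2
    exact (c.proj_eq_iff _ h1 _ h2).1 h3
  have : BaireSpace U := hUo.baireSpace
  have hd := dense_iUnion_interior_of_closed hS hcov
  have hx := hd ⟨x, hxU⟩
  -- Since the group is finite, `x` lies in the closure of one interior. The maps and their
  -- differentials agree on that interior, and both equalities are closed conditions, so they hold
  -- at `x`.
  rw [closure_iUnion_of_finite, Set.mem_iUnion] at hx
  obtain ⟨g, hg⟩ := hx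
  have hgx : (⟨x, hxU⟩ : U) ∈ S g := (hS g).closure_subset_iff.2 interior_subset hg
  refine ⟨g, hgx, ?_⟩
  have hD : IsClosed {z : U | fderiv ℝ (c.act g ∘ φ) z = fderiv ℝ ψ z} :=
    isClosed_eq (cont _ (hcomp g)).2 cψ.2
  have hsub : interior (S g) ⊆ {z : U | fderiv ℝ (c.act g ∘ φ) z = fderiv ℝ ψ z} := by
    intro z hz
    refine EventuallyEq.fderiv_eq ?_
    have h1 : Subtype.val '' interior (S g) ∈ 𝓝 (z : M) :=
      (hUo.isOpenMap_subtype_val _ isOpen_interior).mem_nhds ⟨z, hz, rfl⟩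
    filter_upwards [h1]
    rintro _ ⟨y, hy, rfl⟩
    have hyS : y ∈ S g := interior_subset hy
    exact hyS
  have := hD.closure_subset_iff.2 hsub hg
  rw [← fderiv_comp x ((c.contDiffAt_act g (hU x hxU).2.1).differentiableAt (by simp))
    (hφ.differentiableAt (by simp))]
  exact this

/-- A germ of a `C¹` map over `X` from the domain of `c` to the domain of `d` takes the tangent
vector `u` at `x` to the tangent vector `w` at `y`. -/
def GermRel (c d : OrbifoldChart M X) (x u y w : M) : Prop :=
  ∃ φ : M → M, ContDiffAt ℝ 1 φ x ∧ (∀ᶠ z in 𝓝 x, φ z ∈ d.V ∧ d.proj (φ z) = c.proj z) ∧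
    φ x = y ∧ fderiv ℝ φ x u = w

/-- Composition is the reason for working with germs: two injections in a row with mismatched
intermediate charts need not compose, whereas germs over `X` always do. -/
theorem GermRel.trans {b c d : OrbifoldChart M X} {x u y v z w : M}
    (h : GermRel b c x u y v) (h' : GermRel c d y v z w) : GermRel b d x u z w := by
  obtain ⟨φ, hφ, h1, rfl, rfl⟩ := h
  obtain ⟨ψ, hψ, h2, rfl, rfl⟩ := h'
  refine ⟨ψ ∘ φ, hψ.comp x hφ, ?_, rfl, ?_⟩
  · filter_upwards [h1, hφ.continuousAt.eventually h2] with t ht1 ht2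
    exact ⟨ht2.1, ht2.2.trans ht1.2⟩
  · rw [fderiv_comp x (hψ.differentiableAt (by simp)) (hφ.differentiableAt (by simp))]
    rfl

theorem Injection.germRel {c d : OrbifoldChart M X} (i : Injection c d) {x : M} (hx : x ∈ c.V)
    (u : M) : GermRel c d x u (i.toFun x) (fderiv ℝ i.toFun x u) := by
  refine ⟨i.toFun, i.contDiffAt_one hx, ?_, rfl, rfl⟩
  filter_upwards [c.isOpen_V.mem_nhds hx] with z hz
  exact ⟨i.mapsTo z hz, i.proj_comp z hz⟩

/-- The inverse function theorem supplies a local inverse, which is again a map over `X`. -/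
theorem Injection.germRel_symm [CompleteSpace M] {c d : OrbifoldChart M X} (i : Injection c d)
    {x : M} (hx : x ∈ c.V) (u : M) :
    GermRel d c (i.toFun x) (fderiv ℝ i.toFun x u) x u := by
  have hb := i.bijective_fderiv x hx
  let L := ContinuousLinearEquiv.ofBijective (fderiv ℝ i.toFun x)
    (LinearMap.ker_eq_bot.2 hb.1) (LinearMap.range_eq_top.2 hb.2)
  have hd : HasFDerivAt i.toFun (L : M →L[ℝ] M) x := by
    exact ((i.contDiffAt_one hx).differentiableAt (by simp)).hasFDerivAt
  have hs : HasStrictFDerivAt i.toFun (L : M →L[ℝ] M) x :=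
    (i.contDiffAt_one hx).hasStrictFDerivAt' hd (by simp)
  have h0 : hs.localInverse i.toFun L x (i.toFun x) = x := hs.localInverse_apply_image
  have h1 : ContDiffAt ℝ 1 (hs.localInverse i.toFun L x) (i.toFun x) :=
    (i.contDiffAt_one hx).to_localInverse hd (by simp)
  have h2 := hs.to_localInverse
  refine ⟨hs.localInverse i.toFun L x, h1, ?_, h0, ?_⟩
  · have hV : ∀ᶠ z in 𝓝 (hs.localInverse i.toFun L x (i.toFun x)), z ∈ c.V := by
      rw [h0]
      exact c.isOpen_V.mem_nhds hx
    filter_upwards [hs.eventually_right_inverse, h1.continuousAt.eventually hV] with z hz hzV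
    refine ⟨hzV, ?_⟩
    rw [← i.proj_comp _ hzV]
    exact congrArg _ hz
  · rw [h2.hasFDerivAt.fderiv]
    exact L.symm_apply_apply u

/-- The germ is compared with the identity germ. -/
theorem GermRel.exists_act [CompleteSpace M] {c : OrbifoldChart M X} {x u y w : M} (hx : x ∈ c.V)
    (h : GermRel c c x u y w) : ∃ g, c.act g x = y ∧ fderiv ℝ (c.act g) x u = w := by
  obtain ⟨φ, hφ, h1, rfl, rfl⟩ := h
  obtain ⟨g, hg, hg'⟩ := c.exists_act_eq_fderiv_comp_eq (φ := id) contDiffAt_id hφ (by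
    filter_upwards [h1, c.isOpen_V.mem_nhds hx] with z hz hzV
    exact ⟨hzV, hz.1, hz.2.symm⟩)
  refine ⟨g, hg, ?_⟩
  rw [← hg', fderiv_id]
  rfl

end OrbifoldChart

/-! ### Equality, lifts and open sets in the tangent bundle. -/

namespace Orbifold

open OrbifoldChart

variable {M X : Type*} [NormedAddCommGroup M] [NormedSpace ℝ M] [TopologicalSpace X]
  {Q : Orbifold M X}

theorem continuous_tangentMk (c : Q.atlas) :
    Continuous fun p : c.1.V × M => Tangent.mk c p.1 p.2 :=
  continuous_quot_mk.comp (continuous_sigmaMk (σ := fun c : Q.atlas => c.1.V × M))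

theorem continuous_tangentProj : Continuous Q.tangentProj := by
  refine continuous_quot_lift _ ?_
  refine continuous_sigma fun c => ?_
  exact (continuousOn_iff_continuous_domRestrict.1 c.1.continuousOn_proj).comp continuous_fst

theorem tangentMk_eq_of_injection {c d : Q.atlas} {e : OrbifoldChart M X}
    (i : OrbifoldChart.Injection e c.1) (j : OrbifoldChart.Injection e d.1) {z : M} (hz : z ∈ e.V)
    (Z : M) :
    Tangent.mk c ⟨i.toFun z, i.mapsTo z hz⟩ (fderiv ℝ i.toFun z Z) =
      Tangent.mk d ⟨j.toFun z, j.mapsTo z hz⟩ (fderiv ℝ j.toFun z Z) :=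
  Quot.sound ⟨e, i, j, z, hz, Z, rfl, rfl, rfl, rfl⟩

/-- A group element is an injection of the chart into itself, and pairing it with the identity
injection is an instance of the defining relation. -/
theorem tangentMk_act (c : Q.atlas) (g : c.1.G) {x : M} (hx : x ∈ c.1.V) (u : M) :
    Tangent.mk c ⟨c.1.act g x, c.1.act_mem g x hx⟩ (fderiv ℝ (c.1.act g) x u) =
      Tangent.mk c ⟨x, hx⟩ u := by
  refine (tangentMk_eq_of_injection (c := c) (d := c) (Injection.ofAct c.1 g) (Injection.refl c.1)
    hx u).trans ?_
  have : fderiv ℝ (Injection.refl c.1).toFun x u = u := by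
    change fderiv ℝ id x u = u
    rw [fderiv_id]
    rfl
  rw [this]
  rfl

theorem germRel_of_tangentMk_eq [CompleteSpace M] {c d : Q.atlas} {x : c.1.V} {u : M} {y : d.1.V}
    {w : M} (h : Tangent.mk c x u = Tangent.mk d y w) : GermRel c.1 d.1 x u y w := by
  have key : ∀ a b : Q.PreTangent, Q.TangentRel a b →
      GermRel a.1.1 b.1.1 a.2.1 a.2.2 b.2.1 b.2.2 := by
    rintro ⟨c, x, u⟩ ⟨d, y, w⟩ ⟨e, i, j, z, hz, Z, h1, h2, h3, h4⟩
    dsimp only at h1 h2 h3 h4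
    rw [← h1, ← h2, ← h3, ← h4]
    exact (i.germRel_symm hz Z).trans (j.germRel hz Z)
  have hs : ∀ a b : Q.PreTangent, Q.TangentRel a b → Q.TangentRel b a := by
    rintro a b ⟨e, i, j, z, hz, Z, h1, h2, h3, h4⟩
    exact ⟨e, j, i, z, hz, Z, h3, h4, h1, h2⟩
  -- Both directions are carried through the induction, because `GermRel` allows noninvertible germs
  -- and is not visibly symmetric.
  have hg : ∀ a b : Q.PreTangent, Relation.EqvGen Q.TangentRel a b →
      GermRel a.1.1 b.1.1 a.2.1 a.2.2 b.2.1 b.2.2 ∧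
        GermRel b.1.1 a.1.1 b.2.1 b.2.2 a.2.1 a.2.2 := by
    intro a b hab
    induction hab with
    | rel a b h => exact ⟨key a b h, key b a (hs a b h)⟩
    | refl a =>
      have hr := (Injection.refl a.1.1).germRel a.2.1.2 a.2.2
      have : fderiv ℝ (Injection.refl a.1.1).toFun a.2.1 a.2.2 = a.2.2 := by
        change fderiv ℝ id (a.2.1 : M) a.2.2 = a.2.2
        rw [fderiv_id]
        rfl
      rw [this] at hr
      exact ⟨hr, hr⟩
    | symm a b _ ih => exact ih.symm
    | trans a b c _ _ ih1 ih2 => exact ⟨ih1.1.trans ih2.1, ih2.2.trans ih1.2⟩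
  exact (hg _ _ (Quot.eqvGen_exact h)).1

/-- Every tangent vector over the support of a chart lifts to that chart. -/
theorem exists_tangentMk_eq (c : Q.atlas) (ξ : Q.Tangent) (h : Q.tangentProj ξ ∈ c.1.support) :
    ∃ x u, Tangent.mk c x u = ξ := by
  induction ξ using Quot.ind with
  | mk a =>
  obtain ⟨d, ⟨y, hy⟩, w⟩ := a
  obtain ⟨e, ⟨z, hz, hzq⟩, ⟨i⟩, ⟨j⟩⟩ := Q.compatible c.1 c.2 d.1 d.2 _ h ⟨y, hy, rfl⟩
  have h1 : d.1.proj y = d.1.proj (j.toFun z) := by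
    rw [j.proj_comp z hz, hzq]
    rfl
  -- The lift in `d` is moved by `g` to the image of `j`, pulled back to `e` and pushed to `c` by
  -- `i`.
  obtain ⟨g, hg⟩ := (d.1.proj_eq_iff y hy _ (j.mapsTo z hz)).1 h1
  obtain ⟨Z, hZ⟩ := (j.bijective_fderiv z hz).2 (fderiv ℝ (d.1.act g) y w)
  refine ⟨⟨i.toFun z, i.mapsTo z hz⟩, fderiv ℝ i.toFun z Z, ?_⟩
  rw [tangentMk_eq_of_injection i j hz Z, hZ]
  refine Eq.trans ?_ (tangentMk_act d g hy w)
  congr 2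
  exact hg.symm

/-- Lifts of a tangent vector over the support of a chart injecting into a chart of the atlas. -/
theorem exists_tangentMk_injection_eq {c : Q.atlas} {e : OrbifoldChart M X}
    (i : OrbifoldChart.Injection e c.1) (ξ : Q.Tangent) (h : Q.tangentProj ξ ∈ e.support) :
    ∃ z, ∃ hz : z ∈ e.V, ∃ Z,
      Tangent.mk c ⟨i.toFun z, i.mapsTo z hz⟩ (fderiv ℝ i.toFun z Z) = ξ := by
  obtain ⟨z, hz, hzq⟩ := h
  obtain ⟨⟨x, hx⟩, u, rfl⟩ := exists_tangentMk_eq c ξ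
    ⟨i.toFun z, i.mapsTo z hz, by rw [i.proj_comp z hz, hzq]⟩
  have h1 : c.1.proj x = c.1.proj (i.toFun z) := by
    rw [i.proj_comp z hz, hzq]
    rfl
  obtain ⟨g, hg⟩ := (c.1.proj_eq_iff x hx _ (i.mapsTo z hz)).1 h1
  obtain ⟨Z, hZ⟩ := (i.bijective_fderiv z hz).2 (fderiv ℝ (c.1.act g) x u)
  refine ⟨z, hz, Z, ?_⟩
  rw [hZ]
  refine Eq.trans ?_ (tangentMk_act c g hx u)
  congr 2
  exact hg.symm

/-- The left vector also has some lift in `d`. That lift and `(y, w)` are joined by a germ within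
`d`, hence by a group element. -/
theorem tangentMk_eq_of_germRel [CompleteSpace M] {c d : Q.atlas} {x : c.1.V} {u : M} {y : d.1.V}
    {w : M} (h : GermRel c.1 d.1 x u y w) : Tangent.mk c x u = Tangent.mk d y w := by
  have hp : c.1.proj x = d.1.proj y := by
    obtain ⟨φ, -, h1, h2, -⟩ := h
    rw [← h1.self_of_nhds.2, h2]
  obtain ⟨y', w', h'⟩ := exists_tangentMk_eq d (Tangent.mk c x u)
    ⟨y, y.2, hp.symm⟩
  obtain ⟨g, hg, hg'⟩ := ((germRel_of_tangentMk_eq h').trans h).exists_act y'.2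
  rw [← h', ← tangentMk_act d g y'.2 w', hg']
  congr 2

theorem tangentMk_injection_eq_iff [CompleteSpace M] {c : Q.atlas} {e : OrbifoldChart M X}
    (i : OrbifoldChart.Injection e c.1) {z z' : M} (hz : z ∈ e.V) (hz' : z' ∈ e.V) (Z Z' : M) :
    Tangent.mk c ⟨i.toFun z, i.mapsTo z hz⟩ (fderiv ℝ i.toFun z Z) =
      Tangent.mk c ⟨i.toFun z', i.mapsTo z' hz'⟩ (fderiv ℝ i.toFun z' Z') ↔
    ∃ g, e.act g z = z' ∧ fderiv ℝ (e.act g) z Z = Z' := by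
  constructor
  · intro h
    exact (((i.germRel hz Z).trans (germRel_of_tangentMk_eq h)).trans
      (i.germRel_symm hz' Z')).exists_act hz
  · rintro ⟨g, rfl, rfl⟩
    refine tangentMk_eq_of_germRel ?_
    exact ((i.germRel_symm hz Z).trans ((Injection.ofAct e g).germRel hz Z)).trans
      (i.germRel hz' _)

/-- Openness is tested in each chart `d`. One germ from `d` to `c` transports all nearby tangent
vectors, and it keeps them in `W` because its differential is continuous. -/
theorem isOpen_image_tangentMk [CompleteSpace M] (c : Q.atlas) {W : Set (M × M)} (hW : IsOpen W) :
    IsOpen {ξ : Q.Tangent | ∃ (x : c.1.V) (u : M), ((x : M), u) ∈ W ∧ Tangent.mk c x u = ξ} := by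
  refine isOpen_coinduced.2 (isOpen_sigma_iff.2 fun d => isOpen_iff_mem_nhds.2 ?_)
  rintro ⟨y, w⟩ ⟨x, u, hxu, h⟩
  obtain ⟨φ, hφ, h1, h2, h3⟩ := germRel_of_tangentMk_eq (c := d) (d := c) h.symm
  have hc : ContinuousAt (fun p : d.1.V × M => (φ p.1, fderiv ℝ φ p.1 p.2)) (y, w) := by
    have hv : ContinuousAt (fun p : d.1.V × M => (p.1 : M)) (y, w) := by fun_prop
    have hf : ContinuousAt (fderiv ℝ φ) (y : M) :=
      (hφ.fderiv_right (m := 0) (by simp)).continuousAt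
    refine ContinuousAt.prodMk (ContinuousAt.comp (f := fun p : d.1.V × M => (p.1 : M)) (x := (y, w))
      hφ.continuousAt hv) ?_
    exact (ContinuousAt.comp (f := fun p : d.1.V × M => (p.1 : M)) (x := (y, w)) hf hv).clm_apply
      continuousAt_snd
  have hWn : ∀ᶠ p in 𝓝 (φ y, fderiv ℝ φ y w), p ∈ W := by
    rw [h2, h3]
    exact hW.mem_nhds hxu
  have hv : Tendsto (fun p : d.1.V × M => (p.1 : M)) (𝓝 (y, w)) (𝓝 (y : M)) :=
    Continuous.tendsto (by fun_prop) (y, w)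
  -- The germ conditions at `y` also hold at all nearby points, so the same `φ` serves as a germ
  -- there.
  filter_upwards [hc.eventually hWn,
    hv.eventually (h1.eventually_nhds.and (hφ.eventually (by simp)))] with p hp1 hp2
  refine ⟨⟨φ p.1, hp2.1.self_of_nhds.1⟩, fderiv ℝ φ p.1 p.2, hp1, ?_⟩
  exact (tangentMk_eq_of_germRel ⟨φ, hp2.2, hp2.1, rfl, rfl⟩).symm

end Orbifold

/-! ### Local diffeomorphisms, fibrewise linear maps and separation in chart quotients. -/

theorem isOpen_image_of_bijective_fderiv {E : Type*} [NormedAddCommGroup E] [NormedSpace ℝ E]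
    [CompleteSpace E] {f : E → E} {W : Set E} (hW : IsOpen W)
    (h : ∀ x ∈ W, ContDiffAt ℝ 1 f x ∧ Function.Bijective (fderiv ℝ f x)) : IsOpen (f '' W) := by
  refine isOpen_iff_mem_nhds.2 ?_
  rintro _ ⟨x, hx, rfl⟩
  obtain ⟨hf, hb⟩ := h x hx
  let L := ContinuousLinearEquiv.ofBijective (fderiv ℝ f x)
    (LinearMap.ker_eq_bot.2 hb.1) (LinearMap.range_eq_top.2 hb.2)
  have hd : HasFDerivAt f (L : E →L[ℝ] E) x := (hf.differentiableAt (by simp)).hasFDerivAt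
  have hs : HasStrictFDerivAt f (L : E →L[ℝ] E) x := hf.hasStrictFDerivAt' hd (by simp)
  rw [← hs.map_nhds_eq_of_equiv]
  exact image_mem_map (hW.mem_nhds hx)

section FiberwiseLinear

variable {M F : Type*} [NormedAddCommGroup M] [NormedSpace ℝ M] [NormedAddCommGroup F]
  [NormedSpace ℝ F] {φ : M → M} {A : M → F →L[ℝ] F} {x : M}

theorem contDiffAt_fiberwiseLinear (hφ : ContDiffAt ℝ 1 φ x) (hA : ContDiffAt ℝ 1 A x) (v : F) :
    ContDiffAt ℝ 1 (fun p : M × F => (φ p.1, A p.1 p.2)) (x, v) :=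
  (hφ.comp (x, v) contDiffAt_fst).prodMk ((hA.comp (x, v) contDiffAt_fst).clm_apply contDiffAt_snd)

theorem fderiv_fiberwiseLinear (hφ : ContDiffAt ℝ 1 φ x) (hA : ContDiffAt ℝ 1 A x) (v : F)
    (p : M × F) :
    fderiv ℝ (fun p : M × F => (φ p.1, A p.1 p.2)) (x, v) p =
      (fderiv ℝ φ x p.1, A x p.2 + fderiv ℝ A x p.1 v) := by
  have hf : HasFDerivAt (Prod.fst : M × F → M) (ContinuousLinearMap.fst ℝ M F) (x, v) :=
    hasFDerivAt_fst
  have hs : HasFDerivAt (Prod.snd : M × F → F) (ContinuousLinearMap.snd ℝ M F) (x, v) :=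
    hasFDerivAt_snd
  have h1 := (hφ.differentiableAt (by simp)).hasFDerivAt
  have h2 := (hA.differentiableAt (by simp)).hasFDerivAt
  have h3 := (HasFDerivAt.comp (x, v) h1 hf).prodMk ((HasFDerivAt.comp (x, v) h2 hf).clm_apply hs)
  refine (congrArg (fun L : M × F →L[ℝ] M × F => L p) h3.fderiv).trans ?_
  simp

theorem bijective_fderiv_fiberwiseLinear (hφ : ContDiffAt ℝ 1 φ x) (hA : ContDiffAt ℝ 1 A x)
    (bφ : Function.Bijective (fderiv ℝ φ x)) (bA : Function.Bijective (A x)) (v : F) :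
    Function.Bijective (fderiv ℝ (fun p : M × F => (φ p.1, A p.1 p.2)) (x, v)) := by
  constructor
  · rw [injective_iff_map_eq_zero]
    rintro ⟨a, b⟩ hab
    rw [fderiv_fiberwiseLinear hφ hA, Prod.mk_eq_zero] at hab
    have ha : a = 0 := bφ.1 (by simpa using hab.1)
    subst ha
    have hb : b = 0 := bA.1 (by simpa using hab.2)
    rw [hb]
    rfl
  · rintro ⟨a, b⟩
    obtain ⟨a', ha'⟩ := bφ.2 a
    obtain ⟨b', hb'⟩ := bA.2 (b - fderiv ℝ A x a' v)
    refine ⟨(a', b'), ?_⟩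
    rw [fderiv_fiberwiseLinear hφ hA]
    simp [ha', hb']

end FiberwiseLinear

/-- Points with different images in the quotient are separated by open sets. -/
theorem OrbifoldChart.exists_separating {M X : Type*} [NormedAddCommGroup M] [NormedSpace ℝ M]
    [TopologicalSpace X] (c : OrbifoldChart M X) {x y : M} (hx : x ∈ c.V) (hy : y ∈ c.V)
    (h : c.proj x ≠ c.proj y) :
    ∃ U V : Set X, IsOpen U ∧ IsOpen V ∧ c.proj x ∈ U ∧ c.proj y ∈ V ∧ Disjoint U V := by
  -- Each inequality is an open condition, and finiteness of the group lets all of them hold on one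
  -- neighbourhood.
  have hev : ∀ᶠ p : M × M in 𝓝 (x, y), ∀ g, c.act g p.1 ≠ p.2 := by
    refine eventually_all.2 fun g => ?_
    have hc : ContinuousAt (fun p : M × M => c.act g p.1) (x, y) :=
      ContinuousAt.comp (f := Prod.fst) (x := (x, y)) (c.contDiffAt_act g hx).continuousAt
        continuousAt_fst
    refine (hc.ne_iff_eventually_ne continuousAt_snd).1 ?_
    intro hg
    exact h ((c.proj_eq_iff x hx y hy).2 ⟨g, hg⟩)
  have hV : ∀ᶠ p : M × M in 𝓝 (x, y), p ∈ c.V ×ˢ c.V :=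
    (c.isOpen_V.prod c.isOpen_V).mem_nhds ⟨hx, hy⟩
  obtain ⟨u, v, hu, hxu, hv, hyv, huv⟩ := mem_nhds_prod_iff'.1 (hev.and hV)
  have huV : u ⊆ c.V := fun a ha => (huv (Set.mk_mem_prod ha hyv)).2.1
  have hvV : v ⊆ c.V := fun b hb => (huv (Set.mk_mem_prod hxu hb)).2.2
  refine ⟨c.proj '' u, c.proj '' v, c.isOpen_image u huV hu, c.isOpen_image v hvV hv,
    ⟨x, hxu, rfl⟩, ⟨y, hyv, rfl⟩, Set.disjoint_left.2 ?_⟩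
  rintro _ ⟨a, ha, rfl⟩ ⟨b, hb, hab⟩
  obtain ⟨g, hg⟩ := (c.proj_eq_iff a (huV ha) b (hvV hb)).1 hab.symm
  exact (huv (Set.mk_mem_prod ha hb)).1 g hg

namespace OrbifoldBundleChart

variable {M X T F : Type*} [NormedAddCommGroup M] [NormedSpace ℝ M]
  [NormedAddCommGroup F] [NormedSpace ℝ F] [TopologicalSpace X] [TopologicalSpace T]
  {ρ : T → X} {c d : OrbifoldChart M X}

theorem contDiffAt_lin (C : OrbifoldBundleChart F ρ c) (g : c.G) {x : M} (hx : x ∈ c.V) :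
    ContDiffAt ℝ 1 (C.lin g) x :=
  ((C.contDiffOn_lin g).contDiffAt (c.isOpen_V.mem_nhds hx)).of_le (by simp)

theorem fderiv_total_act (C : OrbifoldBundleChart F ρ c) (g : c.G) {x : M} (hx : x ∈ c.V)
    (v w : F) : fderiv ℝ (C.total.act g) (x, v) (0, w) = (0, C.lin g x w) := by
  refine (fderiv_fiberwiseLinear (c.contDiffAt_act g hx) (C.contDiffAt_lin g hx) v (0, w)).trans ?_
  simp

namespace Injection

/-- The identity injection. -/
def refl (C : OrbifoldBundleChart F ρ c) : Injection C C where
  base := OrbifoldChart.Injection.refl c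
  lin _ := ContinuousLinearMap.id ℝ F
  contDiffOn_lin := contDiffOn_const
  bijective_lin _ _ := Function.bijective_id
  equivariant _ _ _ := rfl
  proj_comp _ _ _ := rfl

variable {C : OrbifoldBundleChart F ρ c} {D : OrbifoldBundleChart F ρ d}

theorem contDiffAt_lin (i : Injection C D) {x : M} (hx : x ∈ c.V) : ContDiffAt ℝ ∞ i.lin x :=
  i.contDiffOn_lin.contDiffAt (c.isOpen_V.mem_nhds hx)

theorem fderiv_total (i : Injection C D) {x : M} (hx : x ∈ c.V) (v : F) (p : M × F) :
    fderiv ℝ i.total.toFun (x, v) p =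
      (fderiv ℝ i.base.toFun x p.1, i.lin x p.2 + fderiv ℝ i.lin x p.1 v) :=
  fderiv_fiberwiseLinear (i.base.contDiffAt_one hx) ((i.contDiffAt_lin hx).of_le (by simp)) v p

theorem fderiv_total_zero (i : Injection C D) {x : M} (hx : x ∈ c.V) (v w : F) :
    fderiv ℝ i.total.toFun (x, v) (0, w) = (0, i.lin x w) := by
  simp [i.fderiv_total hx v]

end Injection

end OrbifoldBundleChart

/-! ### The vertical tangent bundle. -/

namespace OrbifoldVectorBundle

open OrbifoldBundleChart

variable {M X F T : Type*} [NormedAddCommGroup M] [NormedSpace ℝ M] [TopologicalSpace X]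
  [NormedAddCommGroup F] [NormedSpace ℝ F] [TopologicalSpace T] {Q : Orbifold M X}
  (E : OrbifoldVectorBundle Q F T) {c d e : OrbifoldChart M X}
  {C : OrbifoldBundleChart F E.proj c} {D : OrbifoldBundleChart F E.proj d}
  {B : OrbifoldBundleChart F E.proj e}

theorem tangentMk_injection (hC : C ∈ E.atlas c) (i : Injection B C) {z : M} (hz : z ∈ e.V)
    (s w : F) :
    E.tangentMk hC (i.base.mapsTo z hz) (i.lin z s) (0, i.lin z w) =
      Orbifold.Tangent.mk (Q := E.total) ⟨C.total, c, C, hC, rfl⟩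
        ⟨i.total.toFun (z, s), i.total.mapsTo (z, s) ⟨hz, Set.mem_univ _⟩⟩
        (fderiv ℝ i.total.toFun (z, s) (0, w)) := by
  rw [i.fderiv_total_zero hz]
  rfl

theorem tangentMk_transition (hC : C ∈ E.atlas c) (hD : D ∈ E.atlas d) (i : Injection B C)
    (j : Injection B D) {z : M} (hz : z ∈ e.V) (s w : F) :
    E.tangentMk hC (i.base.mapsTo z hz) (i.lin z s) (0, i.lin z w) =
      E.tangentMk hD (j.base.mapsTo z hz) (j.lin z s) (0, j.lin z w) := by
  rw [E.tangentMk_injection hC i hz, E.tangentMk_injection hD j hz]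
  exact Orbifold.tangentMk_eq_of_injection (Q := E.total) (c := ⟨C.total, c, C, hC, rfl⟩)
    (d := ⟨D.total, d, D, hD, rfl⟩) i.total j.total ⟨hz, Set.mem_univ _⟩ (0, w)

theorem continuous_tangentProj_vertical :
    Continuous fun ξ : E.Vertical => E.total.tangentProj ξ.1 :=
  Orbifold.continuous_tangentProj.comp continuous_subtype_val

theorem exists_mem_support_total (t : T) :
    ∃ c, ∃ C ∈ E.atlas c, t ∈ C.total.support := by
  obtain ⟨c, C, hC, hq⟩ := E.cover (E.proj t)
  obtain ⟨x, hx, v, hv⟩ := C.exists_proj t hq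
  exact ⟨c, C, hC, (x, v), ⟨hx, Set.mem_univ _⟩, hv⟩

theorem isChart_of_mem_atlas (hC : C ∈ E.atlas c) : E.IsChart C :=
  ⟨E.isChart_base c C hC, E.compatible c C hC⟩

section Complete

variable [CompleteSpace M] [CompleteSpace F]

theorem tangentMk_injection_eq_iff (hC : C ∈ E.atlas c) (i : Injection B C) {z z' : M}
    (hz : z ∈ e.V) (hz' : z' ∈ e.V) (s s' w w' : F) :
    E.tangentMk hC (i.base.mapsTo z hz) (i.lin z s) (0, i.lin z w) =
      E.tangentMk hC (i.base.mapsTo z' hz') (i.lin z' s') (0, i.lin z' w') ↔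
    ∃ g, (e.act g z = z' ∧ B.lin g z s = s') ∧ B.lin g z w = w' := by
  rw [E.tangentMk_injection hC i hz, E.tangentMk_injection hC i hz']
  refine (Orbifold.tangentMk_injection_eq_iff (Q := E.total) (c := ⟨C.total, c, C, hC, rfl⟩)
    i.total (z := (z, s)) (z' := (z', s')) ⟨hz, Set.mem_univ _⟩ ⟨hz', Set.mem_univ _⟩
    (0, w) (0, w')).trans (exists_congr fun g => ?_)
  refine and_congr Prod.ext_iff ?_
  refine (Eq.congr_left (B.fderiv_total_act g hz s w)).trans ?_
  simp

theorem tangentMk_eq_iff (hC : C ∈ E.atlas c) {z z' : M} (hz : z ∈ c.V) (hz' : z' ∈ c.V)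
    (s s' w w' : F) :
    E.tangentMk hC hz s (0, w) = E.tangentMk hC hz' s' (0, w') ↔
    ∃ g, (c.act g z = z' ∧ C.lin g z s = s') ∧ C.lin g z w = w' :=
  E.tangentMk_injection_eq_iff hC (Injection.refl C) hz hz' s s' w w'

/-- Verticality concerns every lift, so one vertical lift must be shown to suffice. It is carried
through a common chart `B` to a vertical lift in `D`; any other lift in `D` differs by a group
element, whose differential preserves the fibre direction. -/
theorem isVertical_tangentMk (hC : C ∈ E.atlas c) {x : M} (hx : x ∈ c.V) (v w : F) :
    E.IsVertical (E.tangentMk hC hx v (0, w)) := by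
  intro d D hD y hy v' u h
  have hp : D.proj (y, v') = C.proj (x, v) := congrArg E.total.tangentProj h
  have hqc : E.proj (C.proj (x, v)) ∈ c.support := ⟨x, hx, (C.base_proj x hx v).symm⟩
  have hqd : E.proj (C.proj (x, v)) ∈ d.support := by
    rw [← hp]
    exact ⟨y, hy, (D.base_proj y hy v').symm⟩
  obtain ⟨e, B, he, ⟨i⟩, ⟨j⟩⟩ := E.compatible c C hC d D hD _ hqc hqd
  obtain ⟨z, hz, s, hs⟩ := B.exists_proj _ he
  rw [← i.proj_comp z hz] at hs
  obtain ⟨g, hg⟩ := (C.proj_eq_iff x hx v _ (i.base.mapsTo z hz) _).1 hs.symm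
  obtain ⟨w', hw'⟩ := (i.bijective_lin z hz).2 (C.lin g x w)
  have h1 := (E.tangentMk_eq_iff hC hx (i.base.mapsTo z hz) v (i.lin z s) w (i.lin z w')).2
    ⟨g, hg, hw'.symm⟩
  rw [h1, E.tangentMk_transition hC hD i j hz] at h
  have hjz : (j.base.toFun z, j.lin z s) ∈ D.total.V := ⟨j.base.mapsTo z hz, Set.mem_univ _⟩
  obtain ⟨k, -, hk⟩ := (Orbifold.germRel_of_tangentMk_eq h.symm).exists_act hjz
  rw [← hk]
  exact congrArg Prod.fst (D.fderiv_total_act k (j.base.mapsTo z hz) (j.lin z s) (j.lin z w'))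

/-- The vertical vector with the lift `(0, w)` at the point `(x, v)` of a bundle chart. -/
noncomputable def verticalMk (hC : C ∈ E.atlas c) {x : M} (hx : x ∈ c.V) (v w : F) : E.Vertical :=
  ⟨E.tangentMk hC hx v (0, w), E.isVertical_tangentMk hC hx v w⟩

theorem continuous_verticalMk (hC : C ∈ E.atlas c) :
    Continuous fun p : c.V × F × F => E.verticalMk hC p.1.2 p.2.1 p.2.2 := by
  refine Continuous.subtype_mk ?_ _
  refine (Orbifold.continuous_tangentMk (Q := E.total) ⟨C.total, c, C, hC, rfl⟩).comp
    (f := fun p : c.V × F × F => ((⟨(p.1.1, p.2.1), p.1.2, Set.mem_univ _⟩ : C.total.V),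
      ((0, p.2.2) : M × F))) ?_
  fun_prop

theorem isOpen_image_verticalMk (hC : C ∈ E.atlas c) {W : Set ((M × F) × F)} (hW : IsOpen W) :
    IsOpen {ξ : E.Vertical | ∃ (x : M) (hx : x ∈ c.V) (v w : F),
      ((x, v), w) ∈ W ∧ E.verticalMk hC hx v w = ξ} := by
  -- The horizontal component is left free to get an open set of tangent vectors; on `VE` it
  -- vanishes in every lift.
  have hO : IsOpen {p : (M × F) × (M × F) | (p.1, p.2.2) ∈ W} := hW.preimage (by fun_prop)
  convert (Orbifold.isOpen_image_tangentMk (Q := E.total) ⟨C.total, c, C, hC, rfl⟩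
    hO).preimage continuous_subtype_val using 1
  ext ξ
  constructor
  · rintro ⟨x, hx, v, w, hxW, rfl⟩
    exact ⟨⟨(x, v), hx, Set.mem_univ _⟩, (0, w), hxW, rfl⟩
  · rintro ⟨⟨⟨x, v⟩, hx⟩, ⟨a, w⟩, hxW, h⟩
    obtain rfl : a = 0 := ξ.2 c C hC x hx.1 v (a, w) h
    exact ⟨x, hx.1, v, w, hxW, Subtype.ext h⟩

/-- Every vertical vector over the support of a chart injecting into a chart of the atlas lifts to
that chart. -/
theorem exists_verticalMk_eq (hC : C ∈ E.atlas c) (i : Injection B C) (ξ : E.Vertical)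
    (h : E.total.tangentProj ξ.1 ∈ B.total.support) :
    ∃ z, ∃ hz : z ∈ e.V, ∃ s w,
      E.verticalMk hC (i.base.mapsTo z hz) (i.lin z s) (i.lin z w) = ξ := by
  obtain ⟨⟨z, s⟩, hz, ⟨a, w⟩, hξ⟩ := Orbifold.exists_tangentMk_injection_eq (Q := E.total)
    (c := ⟨C.total, c, C, hC, rfl⟩) i.total ξ.1 h
  have h0 := ξ.2 c C hC (i.base.toFun z) (i.base.mapsTo z hz.1) (i.lin z s) _ hξ
  rw [i.fderiv_total hz.1] at h0
  obtain rfl : a = 0 := (i.base.bijective_fderiv z hz.1).1 (by simpa using h0)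
  refine ⟨z, hz.1, s, w, Subtype.ext ?_⟩
  exact (E.tangentMk_injection hC i hz.1 s w).trans hξ

open Classical in
/-- The quotient map of the bundle chart of the vertical tangent bundle over `B`, where `B` injects
into the bundle chart `C` of the atlas. -/
noncomputable def verticalProj (hC : C ∈ E.atlas c) (i : Injection B C) (p : (M × F) × F) :
    E.Vertical :=
  if h : p.1.1 ∈ e.V then
    E.verticalMk hC (i.base.mapsTo _ h) (i.lin p.1.1 p.1.2) (i.lin p.1.1 p.2)
  else E.verticalMk hC (i.base.mapsTo _ e.isConnected_V.nonempty.some_mem) 0 0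

theorem verticalProj_of_mem (hC : C ∈ E.atlas c) (i : Injection B C) {z : M} (hz : z ∈ e.V)
    (s w : F) :
    E.verticalProj hC i ((z, s), w) =
      E.verticalMk hC (i.base.mapsTo z hz) (i.lin z s) (i.lin z w) :=
  dif_pos hz

theorem tangentProj_verticalProj (hC : C ∈ E.atlas c) (i : Injection B C) {z : M} (hz : z ∈ e.V)
    (s w : F) :
    E.total.tangentProj (E.verticalProj hC i ((z, s), w)).1 = B.proj (z, s) := by
  rw [E.verticalProj_of_mem hC i hz]
  exact i.proj_comp z hz s

theorem continuousOn_verticalProj (hC : C ∈ E.atlas c) (i : Injection B C) :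
    ContinuousOn (E.verticalProj hC i) ((e.V ×ˢ Set.univ) ×ˢ Set.univ) := by
  have hm : Set.MapsTo (fun p : (M × F) × F => p.1.1) ((e.V ×ˢ Set.univ) ×ˢ Set.univ) e.V :=
    fun p hp => hp.1.1
  have h1 := i.base.contDiffOn.continuousOn.comp
    (continuous_fst.comp continuous_fst).continuousOn hm
  have hl := i.contDiffOn_lin.continuousOn.comp
    (continuous_fst.comp continuous_fst).continuousOn hm
  have h2 := hl.clm_apply (continuous_snd.comp continuous_fst).continuousOn
  have h3 := hl.clm_apply continuous_snd.continuousOn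
  rw [continuousOn_iff_continuous_domRestrict] at h1 h2 h3 ⊢
  refine ((E.continuous_verticalMk hC).comp
    ((h1.subtype_mk fun p => i.base.mapsTo _ p.2.1.1).prodMk (h2.prodMk h3))).congr ?_
  rintro ⟨⟨⟨z, s⟩, w⟩, hz⟩
  exact (E.verticalProj_of_mem hC i hz.1.1 s w).symm

theorem isOpen_image_verticalProj (hC : C ∈ E.atlas c) (i : Injection B C)
    (W : Set ((M × F) × F)) (hWV : W ⊆ (e.V ×ˢ Set.univ) ×ˢ Set.univ) (hW : IsOpen W) :
    IsOpen (E.verticalProj hC i '' W) := by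
  -- On `W` the quotient map factors through `G` and the chart over `C`. `G` is fibrewise linear
  -- over `i.total` with invertible differential, hence open.
  let G : (M × F) × F → (M × F) × F := fun q => (i.total.toFun q.1, i.lin q.1.1 q.2)
  have hG : IsOpen (G '' W) := by
    refine isOpen_image_of_bijective_fderiv hW ?_
    rintro ⟨⟨z, s⟩, w⟩ hz
    have hzV : z ∈ e.V := (hWV hz).1.1
    have h1 : ContDiffAt ℝ 1 i.total.toFun (z, s) := i.total.contDiffAt_one ⟨hzV, Set.mem_univ _⟩
    have h2 : ContDiffAt ℝ 1 (fun p : M × F => i.lin p.1) (z, s) :=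
      ((i.contDiffAt_lin hzV).of_le (by simp)).comp (z, s) contDiffAt_fst
    exact ⟨contDiffAt_fiberwiseLinear h1 h2 w, bijective_fderiv_fiberwiseLinear h1 h2
      (i.total.bijective_fderiv _ ⟨hzV, Set.mem_univ _⟩) (i.bijective_lin z hzV) w⟩
  convert E.isOpen_image_verticalMk hC hG using 1
  ext ξ
  constructor
  · rintro ⟨⟨⟨z, s⟩, w⟩, hz, rfl⟩
    have hzV : z ∈ e.V := (hWV hz).1.1
    exact ⟨_, i.base.mapsTo z hzV, _, _, ⟨((z, s), w), hz, rfl⟩,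
      (E.verticalProj_of_mem hC i hzV s w).symm⟩
  · rintro ⟨x, hx, v, w', ⟨⟨⟨z, s⟩, w⟩, hz, hG⟩, rfl⟩
    have hzV : z ∈ e.V := (hWV hz).1.1
    simp only [G, Prod.mk.injEq] at hG
    obtain ⟨h1, rfl⟩ := hG
    obtain ⟨rfl, rfl⟩ := Prod.mk.inj h1
    exact ⟨_, hz, E.verticalProj_of_mem hC i hzV s w⟩

/-- The bundle chart of the vertical tangent bundle over `B`, where `B` injects into the bundle
chart `C` of the atlas. -/
noncomputable def verticalChart (hC : C ∈ E.atlas c) (i : Injection B C) :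
    OrbifoldBundleChart F (fun ξ : E.Vertical => E.total.tangentProj ξ.1) B.total where
  lin g p := B.lin g p.1
  contDiffOn_lin g := (B.contDiffOn_lin g).comp contDiffOn_fst fun _ hp => hp.1
  lin_one p hp := B.lin_one p.1 hp.1
  lin_mul g h p hp := B.lin_mul g h p.1 hp.1
  proj := E.verticalProj hC i
  continuousOn_proj := E.continuousOn_verticalProj hC i
  isOpen_image := E.isOpen_image_verticalProj hC i
  proj_eq_iff := by
    rintro ⟨z, s⟩ hz w ⟨z', s'⟩ hz' w'
    rw [E.verticalProj_of_mem hC i hz.1, E.verticalProj_of_mem hC i hz'.1, Subtype.ext_iff]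
    refine (E.tangentMk_injection_eq_iff hC i hz.1 hz'.1 s s' w w').trans
      (exists_congr fun g => and_congr
        (Prod.ext_iff (x := B.total.act g (z, s)) (y := (z', s'))).symm Iff.rfl)
  base_proj := by
    rintro ⟨z, s⟩ hz w
    exact E.tangentProj_verticalProj hC i hz.1 s w
  exists_proj ξ hξ := by
    obtain ⟨z, hz, s, w, h⟩ := E.exists_verticalMk_eq hC i ξ hξ
    exact ⟨(z, s), ⟨hz, Set.mem_univ _⟩, w, (E.verticalProj_of_mem hC i hz s w).trans h⟩

/-- The injection of the chart of the vertical tangent bundle over `B` into the one over a bundle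
chart `D` of the atlas into which `B` injects. -/
noncomputable def verticalInjection (hC : C ∈ E.atlas c) (hD : D ∈ E.atlas d) (i : Injection B C)
    (j : Injection B D) :
    Injection (E.verticalChart hC i) (E.verticalChart hD (Injection.refl D)) where
  base := j.total
  lin p := j.lin p.1
  contDiffOn_lin := j.contDiffOn_lin.comp contDiffOn_fst fun _ hp => hp.1
  bijective_lin p hp := j.bijective_lin p.1 hp.1
  equivariant g p hp := j.equivariant g p.1 hp.1
  proj_comp := by
    rintro ⟨z, s⟩ hz w
    refine (E.verticalProj_of_mem hD (Injection.refl D) (j.base.mapsTo z hz.1) _ _).trans ?_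
    refine Eq.trans ?_ (E.verticalProj_of_mem hC i hz.1 s w).symm
    exact Subtype.ext (E.tangentMk_transition hD hC j i hz.1 s w)

theorem compatibleAt_verticalChart (hC : C ∈ E.atlas c) (hD : D ∈ E.atlas d) (t : T)
    (htC : t ∈ C.total.support) (htD : t ∈ D.total.support) :
    (E.verticalChart hC (Injection.refl C)).CompatibleAt
      (E.verticalChart hD (Injection.refl D)) t := by
  have hc : E.proj t ∈ c.support := by
    obtain ⟨⟨x, v⟩, hx, rfl⟩ := htC
    exact ⟨x, hx.1, (C.base_proj x hx.1 v).symm⟩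
  have hd : E.proj t ∈ d.support := by
    obtain ⟨⟨x, v⟩, hx, rfl⟩ := htD
    exact ⟨x, hx.1, (D.base_proj x hx.1 v).symm⟩
  obtain ⟨e, B, he, ⟨i⟩, ⟨j⟩⟩ := E.compatible c C hC d D hD _ hc hd
  obtain ⟨z, hz, s, hs⟩ := B.exists_proj t he
  exact ⟨B.total, E.verticalChart hC i, ⟨(z, s), ⟨hz, Set.mem_univ _⟩, hs⟩,
    ⟨E.verticalInjection hC hC i i⟩, ⟨E.verticalInjection hC hD i j⟩⟩

theorem t2Space_vertical : T2Space E.Vertical := by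
  have := E.t2
  refine ⟨fun ξ η hne => ?_⟩
  -- Vectors over one point lie in a common chart, where finiteness of the group separates them;
  -- otherwise their base points are separated in `E`.
  by_cases h : E.total.tangentProj ξ.1 = E.total.tangentProj η.1
  · obtain ⟨c, C, hC, ht⟩ := E.exists_mem_support_total (E.total.tangentProj ξ.1)
    have ht' := ht
    rw [h] at ht'
    obtain ⟨p, hp, v, rfl⟩ := (E.verticalChart hC (Injection.refl C)).exists_proj ξ ht
    obtain ⟨q, hq, w, rfl⟩ := (E.verticalChart hC (Injection.refl C)).exists_proj η ht'
    exact (E.verticalChart hC (Injection.refl C)).total.exists_separating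
      (x := (p, v)) (y := (q, w)) ⟨hp, Set.mem_univ _⟩ ⟨hq, Set.mem_univ _⟩ hne
  · exact separated_by_continuous E.continuous_tangentProj_vertical h

/-- The vertical tangent bundle. -/
noncomputable def vertical : OrbifoldVectorBundle E.total F E.Vertical where
  t2 := E.t2Space_vertical
  proj ξ := E.total.tangentProj ξ.1
  continuous_proj := E.continuous_tangentProj_vertical
  atlas t := {D | ∃ (c : OrbifoldChart M X) (C : OrbifoldBundleChart F E.proj c)
    (hC : C ∈ E.atlas c) (h : C.total = t), h ▸ E.verticalChart hC (Injection.refl C) = D}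
  isChart_base := by
    rintro _ _ ⟨c, C, hC, rfl, rfl⟩
    exact E.total.compatible _ ⟨c, C, hC, rfl⟩
  cover t := by
    obtain ⟨c, C, hC, ht⟩ := E.exists_mem_support_total t
    exact ⟨C.total, _, ⟨c, C, hC, rfl, rfl⟩, ht⟩
  compatible := by
    rintro _ _ ⟨c, C, hC, rfl, rfl⟩ _ _ ⟨d, D, hD, rfl, rfl⟩ t htC htD
    exact E.compatibleAt_verticalChart hC hD t htC htD

theorem verticalChart_mem_atlas (hC : C ∈ E.atlas c) :
    E.verticalChart hC (Injection.refl C) ∈ E.vertical.atlas C.total :=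
  ⟨c, C, hC, rfl, rfl⟩

theorem isVerticalTangentBundle_vertical : E.IsVerticalTangentBundle E.vertical := by
  refine ⟨fun _ => rfl, fun c C hC => ⟨_, E.verticalChart_mem_atlas hC, fun x hx v =>
    ⟨fun w => ?_, fun g w => (C.fderiv_total_act g hx v w).symm⟩⟩⟩
  exact congrArg Subtype.val (E.verticalProj_of_mem hC (Injection.refl C) hx v w)

theorem isGood_vertical : E.vertical.IsGood := by
  intro t
  obtain ⟨c, C, hC, ht⟩ := E.exists_mem_support_total t
  refine ⟨C.total, _, E.vertical.isChart_of_mem_atlas (E.verticalChart_mem_atlas hC), ht,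
    fun g => ⟨fun hg p hp => ?_, fun hg p hp => ?_⟩⟩
  · exact congrArg Prod.fst (hg (p, 0) ⟨hp, Set.mem_univ _⟩)
  · refine Prod.ext (hg p.1 hp.1) ?_
    -- The vertical vector `p.2` is reread as a point of the fibre of `E`, which `g` fixes by
    -- hypothesis.
    have h : C.lin g p.1.1 p.2 = p.2 := congrArg Prod.snd (hg (p.1.1, p.2) ⟨hp.1.1, Set.mem_univ _⟩)
    exact h

end Complete

end OrbifoldVectorBundle

/-! ### The zero section, and transport of bundles along homeomorphisms. -/

namespace OrbifoldVectorBundle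

open OrbifoldBundleChart

variable {M X F T : Type*} [NormedAddCommGroup M] [NormedSpace ℝ M] [TopologicalSpace X]
  [NormedAddCommGroup F] [NormedSpace ℝ F] [TopologicalSpace T] {Q : Orbifold M X}
  (E : OrbifoldVectorBundle Q F T) {c d : OrbifoldChart M X}
  {C : OrbifoldBundleChart F E.proj c} {D : OrbifoldBundleChart F E.proj d}

theorem proj_zeroSection (q : X) : E.proj (E.zeroSection q) = q := by
  obtain ⟨c, C, hC, x, hx, rfl⟩ := E.cover q
  rw [E.zeroSection_proj c C hC x hx, C.base_proj x hx]

theorem continuous_zeroSection : Continuous E.zeroSection := by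
  refine continuous_def.2 fun U hU => isOpen_iff_mem_nhds.2 fun q hq => ?_
  obtain ⟨c, C, hC, x, hx, rfl⟩ := E.cover q
  have hcont : ContinuousOn (fun x => C.proj (x, 0)) c.V :=
    C.continuousOn_proj.comp (by fun_prop) fun z hz => ⟨hz, Set.mem_univ _⟩
  have ho := c.isOpen_image _ Set.inter_subset_left (hcont.isOpen_inter_preimage c.isOpen_V hU)
  refine mem_of_superset (ho.mem_nhds ⟨x, ⟨hx, ?_⟩, rfl⟩) ?_
  · rwa [Set.mem_preimage, E.zeroSection_proj c C hC x hx] at hq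
  · rintro _ ⟨z, ⟨hz, hzU⟩, rfl⟩
    rwa [Set.mem_preimage, E.zeroSection_proj c C hC z hz]

/-- The zero section as an embedding of the domains of a bundle chart. -/
def zeroSectionChart (hC : C ∈ E.atlas c) : SuborbifoldChart E.zeroSection c C.total where
  toFun x := (x, 0)
  hom := MulEquiv.refl c.G
  mapsTo x hx := ⟨hx, Set.mem_univ _⟩
  contDiffOn := by fun_prop
  injOn x _ y _ h := congrArg Prod.fst h
  injective_fderiv x _ := by
    have h : HasFDerivAt (fun x : M => (x, (0 : F))) ((ContinuousLinearMap.id ℝ M).prod 0) x :=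
      (hasFDerivAt_id x).prodMk (hasFDerivAt_const 0 x)
    rw [h.fderiv]
    exact fun a b hab => congrArg Prod.fst hab
  equivariant g x _ := Prod.ext rfl (map_zero (C.lin g x)).symm
  proj_comp x hx := (E.zeroSection_proj c C hC x hx).symm
  mem_image := by
    rintro ⟨x, v⟩ hx ⟨q, hq⟩
    have hq' : E.zeroSection q = C.proj (x, v) := hq
    have h := congrArg E.proj hq'
    rw [E.proj_zeroSection, C.base_proj x hx.1] at h
    rw [h, E.zeroSection_proj c C hC x hx.1] at hq'
    -- A group element takes `(x, 0)` to `(x, v)`; its linear part fixes zero, so `v = 0`.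
    obtain ⟨g, -, hg⟩ := (C.proj_eq_iff x hx.1 0 x hx.1 v).1 hq'
    rw [map_zero] at hg
    exact ⟨x, hx.1, by rw [hg]⟩

theorem isSuborbifoldEmbedding_zeroSection : Q.IsSuborbifoldEmbedding E.total E.zeroSection := by
  refine ⟨Function.LeftInverse.isEmbedding E.proj_zeroSection E.continuous_proj
    E.continuous_zeroSection, fun q => ?_⟩
  obtain ⟨c, C, hC, hq⟩ := E.cover q
  exact ⟨c, C.total, E.isChart_base c C hC, E.total.compatible _ ⟨c, C, hC, rfl⟩, hq,
    ⟨E.zeroSectionChart hC⟩⟩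

/-- The transport of a bundle along a homeomorphism of total spaces over the base. -/
def push {T' : Type*} [TopologicalSpace T'] {ρ' : T' → X} (Φ : T ≃ₜ T')
    (hΦ : ∀ t, ρ' (Φ t) = E.proj t) : OrbifoldVectorBundle Q F T' where
  t2 := by
    have := E.t2
    exact Φ.symm.isEmbedding.t2Space
  proj := ρ'
  continuous_proj := by
    have h : ρ' = E.proj ∘ Φ.symm := funext fun t => by simp [← hΦ]
    rw [h]
    exact E.continuous_proj.comp Φ.symm.continuous
  atlas c := {D | ∃ C ∈ E.atlas c, C.push Φ hΦ = D}
  isChart_base := by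
    rintro c _ ⟨C, hC, rfl⟩
    exact E.isChart_base c C hC
  cover q := by
    obtain ⟨c, C, hC, hq⟩ := E.cover q
    exact ⟨c, _, ⟨C, hC, rfl⟩, hq⟩
  compatible := by
    rintro c _ ⟨C, hC, rfl⟩ d _ ⟨D, hD, rfl⟩ q hqc hqd
    obtain ⟨e, B, he, ⟨i⟩, ⟨j⟩⟩ := E.compatible c C hC d D hD q hqc hqd
    have key : ∀ {d : OrbifoldChart M X} {D : OrbifoldBundleChart F E.proj d} (i : Injection B D),
        Nonempty (Injection (B.push Φ hΦ) (D.push Φ hΦ)) := fun i =>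
      ⟨{ base := i.base
         lin := i.lin
         contDiffOn_lin := i.contDiffOn_lin
         bijective_lin := i.bijective_lin
         equivariant := i.equivariant
         proj_comp := fun x hx v => congrArg Φ (i.proj_comp x hx v) }⟩
    exact ⟨e, B.push Φ hΦ, he, key i, key j⟩

/-- A bundle is isomorphic to its transport along a homeomorphism. -/
def isoPush {T' : Type*} [TopologicalSpace T'] {ρ' : T' → X} (Φ : T ≃ₜ T')
    (hΦ : ∀ t, ρ' (Φ t) = E.proj t) : E.Iso (E.push Φ hΦ) where
  toHomeomorph := Φ
  proj_comp := hΦ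
  isChart_push _ C hC := (E.push Φ hΦ).isChart_of_mem_atlas ⟨C, hC, rfl⟩

/-! ### Identification of the bundle with the restriction of its vertical tangent bundle. -/

section Complete

variable [CompleteSpace M] [CompleteSpace F]

/-- This makes `verticalLift` independent of the chart: transition maps and group elements fix zero
and act on the fibre as on its tangent space at zero. -/
theorem verticalMk_zero_eq_of_proj_eq (hC : C ∈ E.atlas c) (hD : D ∈ E.atlas d) {x y : M}
    (hx : x ∈ c.V) (hy : y ∈ d.V) {v w : F} (h : C.proj (x, v) = D.proj (y, w)) :
    E.verticalMk hC hx 0 v = E.verticalMk hD hy 0 w := by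
  have hqc : E.proj (C.proj (x, v)) ∈ c.support := ⟨x, hx, (C.base_proj x hx v).symm⟩
  have hqd : E.proj (C.proj (x, v)) ∈ d.support := by
    rw [h]
    exact ⟨y, hy, (D.base_proj y hy w).symm⟩
  obtain ⟨e, B, he, ⟨i⟩, ⟨j⟩⟩ := E.compatible c C hC d D hD _ hqc hqd
  obtain ⟨z, hz, s, hs⟩ := B.exists_proj _ he
  have key : ∀ {d : OrbifoldChart M X} {D : OrbifoldBundleChart F E.proj d} (hD : D ∈ E.atlas d)
      (j : Injection B D) {y : M} (hy : y ∈ d.V) {w : F}, D.proj (y, w) = B.proj (z, s) →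
      E.tangentMk hD hy 0 (0, w) =
        E.tangentMk hD (j.base.mapsTo z hz) (j.lin z 0) (0, j.lin z s) := by
    intro d D hD j y hy w h
    rw [← j.proj_comp z hz] at h
    obtain ⟨g, hg, hg'⟩ := (D.proj_eq_iff y hy w _ (j.base.mapsTo z hz) _).1 h
    exact (E.tangentMk_eq_iff hD hy (j.base.mapsTo z hz) 0 (j.lin z 0) w (j.lin z s)).2
      ⟨g, ⟨hg, by simp⟩, hg'⟩
  refine Subtype.ext ?_
  refine (key hC i hx hs.symm).trans ?_
  rw [E.tangentMk_transition hC hD i j hz]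
  exact (key hD j hy (h.symm.trans hs.symm)).symm

theorem exists_verticalMk_zero (t : T) :
    ∃ ξ : E.Vertical, ∃ c, ∃ C, ∃ hC : C ∈ E.atlas c, ∃ x, ∃ hx : x ∈ c.V, ∃ v,
      C.proj (x, v) = t ∧ E.verticalMk hC hx 0 v = ξ := by
  obtain ⟨c, C, hC, ⟨x, v⟩, hx, h⟩ := E.exists_mem_support_total t
  exact ⟨_, c, C, hC, x, hx.1, v, h, rfl⟩

/-- The vertical vector at a point of the zero section given by a point of the fibre. -/
noncomputable def verticalLift (t : T) : E.Vertical := (E.exists_verticalMk_zero t).choose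

theorem verticalLift_proj (hC : C ∈ E.atlas c) {x : M} (hx : x ∈ c.V) (v : F) :
    E.verticalLift (C.proj (x, v)) = E.verticalMk hC hx 0 v := by
  obtain ⟨d, D, hD, y, hy, w, h, h'⟩ := (E.exists_verticalMk_zero (C.proj (x, v))).choose_spec
  exact h'.symm.trans (E.verticalMk_zero_eq_of_proj_eq hD hC hy hx h)

theorem continuous_verticalLift : Continuous E.verticalLift := by
  refine continuous_def.2 fun U hU => isOpen_iff_mem_nhds.2 fun t ht => ?_
  obtain ⟨c, C, hC, ⟨x, v⟩, hx, rfl⟩ := E.exists_mem_support_total t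
  have hcont : ContinuousOn (fun p => E.verticalLift (C.proj p)) (c.V ×ˢ Set.univ) := by
    rw [continuousOn_iff_continuous_domRestrict]
    have h1 : Continuous fun p : (c.V ×ˢ (Set.univ : Set F) : Set (M × F)) =>
        ((⟨p.1.1, p.2.1⟩ : c.V), (0 : F), p.1.2) := by
      fun_prop
    refine ((E.continuous_verticalMk hC).comp h1).congr ?_
    rintro ⟨⟨z, w⟩, hz⟩
    exact (E.verticalLift_proj hC hz.1 w).symm
  have ho := C.isOpen_image _ Set.inter_subset_left
    (hcont.isOpen_inter_preimage (c.isOpen_V.prod isOpen_univ) hU)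
  refine mem_of_superset (ho.mem_nhds ⟨(x, v), ⟨hx, ht⟩, rfl⟩) ?_
  rintro _ ⟨p, ⟨-, hp⟩, rfl⟩
  exact hp

theorem zeroSection_proj_eq (t : T) :
    E.zeroSection (E.proj t) = E.vertical.proj (E.verticalLift t) := by
  obtain ⟨c, C, hC, ⟨x, v⟩, hx, rfl⟩ := E.exists_mem_support_total t
  change E.zeroSection (E.proj (C.proj (x, v))) = E.vertical.proj (E.verticalLift (C.proj (x, v)))
  rw [C.base_proj x hx.1, E.zeroSection_proj c C hC x hx.1, E.verticalLift_proj hC hx.1]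
  rfl

/-- The canonical map from the bundle to the restriction of its vertical tangent bundle along the
zero section. -/
noncomputable def toRestriction (t : T) : RestrictionSpace E.zeroSection E.vertical.proj :=
  ⟨(E.proj t, E.verticalLift t), E.zeroSection_proj_eq t⟩

theorem continuous_toRestriction : Continuous E.toRestriction :=
  (E.continuous_proj.prodMk E.continuous_verticalLift).subtype_mk _

theorem toRestriction_injective : Function.Injective E.toRestriction := by
  intro t t' h
  have h1 : E.proj t = E.proj t' := congrArg (fun p => p.1.1) h
  have h2 : E.verticalLift t = E.verticalLift t' := congrArg (fun p => p.1.2) h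
  obtain ⟨c, C, hC, hq⟩ := E.cover (E.proj t)
  obtain ⟨x, hx, v, rfl⟩ := C.exists_proj t hq
  obtain ⟨y, hy, w, rfl⟩ := C.exists_proj t' (h1 ▸ hq)
  rw [E.verticalLift_proj hC hx, E.verticalLift_proj hC hy] at h2
  obtain ⟨g, hg, hg'⟩ := (E.tangentMk_eq_iff hC hx hy 0 0 v w).1 (congrArg Subtype.val h2)
  exact (C.proj_eq_iff x hx v y hy w).2 ⟨g, hg.1, hg'⟩

/-- The base point of the vertical vector lies on the zero section, which forces `v = 0`. Leaving
`v` arbitrary lets any lift of `p.1.2` be used for surjectivity and openness. -/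
theorem toRestriction_eq (hC : C ∈ E.atlas c) {x : M} (hx : x ∈ c.V) (v w : F)
    (p : RestrictionSpace E.zeroSection E.vertical.proj) (h : E.verticalMk hC hx v w = p.1.2) :
    E.toRestriction (C.proj (x, w)) = p := by
  have h1 : E.zeroSection p.1.1 = C.proj (x, v) := by
    rw [p.2, ← h]
    rfl
  have h2 : p.1.1 = c.proj x := by
    rw [← E.proj_zeroSection p.1.1, h1, C.base_proj x hx]
  rw [h2, E.zeroSection_proj c C hC x hx] at h1
  obtain ⟨g, -, hg⟩ := (C.proj_eq_iff x hx 0 x hx v).1 h1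
  obtain rfl : v = 0 := by rw [← hg, map_zero]
  refine Subtype.ext (Prod.ext ?_ ?_)
  · exact (C.base_proj x hx w).trans h2.symm
  · exact (E.verticalLift_proj hC hx w).trans h

theorem toRestriction_surjective : Function.Surjective E.toRestriction := by
  intro p
  obtain ⟨c, C, hC, ht⟩ := E.exists_mem_support_total (E.vertical.proj p.1.2)
  obtain ⟨x, hx, v, w, h⟩ := E.exists_verticalMk_eq hC (Injection.refl C) p.1.2 ht
  exact ⟨_, E.toRestriction_eq hC hx v w p h⟩

theorem isOpenMap_toRestriction : IsOpenMap E.toRestriction := by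
  intro U hU
  refine isOpen_iff_mem_nhds.2 ?_
  rintro _ ⟨t, ht, rfl⟩
  obtain ⟨c, C, hC, ⟨x, v⟩, hx, rfl⟩ := E.exists_mem_support_total t
  have hp := C.continuousOn_proj.isOpen_inter_preimage (c.isOpen_V.prod isOpen_univ) hU
  -- The fibre coordinate of the base point is unconstrained, which makes the set open;
  -- `toRestriction_eq` makes it zero on the restriction.
  have hW : IsOpen {p : (M × F) × F | (p.1.1, p.2) ∈ (c.V ×ˢ Set.univ) ∩ C.proj ⁻¹' U} :=
    hp.preimage (by fun_prop)
  have hO := (E.isOpen_image_verticalMk hC hW).preimage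
    (f := fun p : RestrictionSpace E.zeroSection E.vertical.proj => p.1.2) (by fun_prop)
  refine mem_of_superset (hO.mem_nhds ?_) ?_
  · exact ⟨x, hx.1, 0, v, ⟨hx, ht⟩, (E.verticalLift_proj hC hx.1 v).symm⟩
  · rintro p ⟨y, hy, s, w, hyw, h⟩
    exact ⟨_, hyw.2, E.toRestriction_eq hC hy s w p h⟩

/-- The bundle is homeomorphic to the restriction of its vertical tangent bundle along the zero
section. -/
noncomputable def homeomorphRestriction :
    T ≃ₜ RestrictionSpace E.zeroSection E.vertical.proj :=
  (Equiv.ofBijective E.toRestriction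
    ⟨E.toRestriction_injective, E.toRestriction_surjective⟩).toHomeomorphOfContinuousOpen
    E.continuous_toRestriction E.isOpenMap_toRestriction

/-- The restriction of the vertical tangent bundle along the zero section. -/
noncomputable def verticalRestriction :
    OrbifoldVectorBundle Q F (RestrictionSpace E.zeroSection E.vertical.proj) :=
  E.push (ρ' := fun p => p.1.1) E.homeomorphRestriction fun _ => rfl

/-- The bundle structure is transported from `E`, so the isomorphism with `E` is automatic and the
content is here: each transported chart is the chart of `VE` over the slice `v = 0`. -/
theorem isRestriction_verticalRestriction :
    IsRestriction E.zeroSection E.vertical E.verticalRestriction := by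
  refine ⟨fun _ => rfl, ?_⟩
  rintro c _ ⟨C, hC, rfl⟩
  refine ⟨C.total, E.verticalChart hC (Injection.refl C), E.zeroSectionChart hC,
    E.vertical.isChart_of_mem_atlas (E.verticalChart_mem_atlas hC), fun _ _ _ => rfl,
    fun x hx v => ?_⟩
  exact (E.verticalLift_proj hC hx v).trans
    (E.verticalProj_of_mem hC (Injection.refl C) hx 0 v).symm

end Complete

end OrbifoldVectorBundle

/-- Every bad orbifold vector bundle `E → Q` is isomorphic to the restriction, along a suborbifold
embedding of `Q`, of a good orbifold vector bundle over a larger orbifold `R`: the embedding is the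
zero section of `E`, the orbifold `R` is the total space of `E`, and the good bundle is the vertical
tangent bundle `VE`. -/
theorem theorem1 {M F X T : Type*}
    [NormedAddCommGroup M] [NormedSpace ℝ M] [FiniteDimensional ℝ M]
    [NormedAddCommGroup F] [NormedSpace ℝ F] [FiniteDimensional ℝ F]
    [TopologicalSpace X] [TopologicalSpace T]
    (Q : Orbifold M X) (E : OrbifoldVectorBundle Q F T) (hE : E.IsBad) :
    Q.IsSuborbifoldEmbedding E.total E.zeroSection ∧
    ∃ VE : OrbifoldVectorBundle E.total F E.Vertical,
      E.IsVerticalTangentBundle VE ∧ VE.IsGood ∧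
      ∃ B : OrbifoldVectorBundle Q F (RestrictionSpace E.zeroSection VE.proj),
        OrbifoldVectorBundle.IsRestriction E.zeroSection VE B ∧ Nonempty (E.Iso B) := by
  have := FiniteDimensional.complete ℝ M
  have := FiniteDimensional.complete ℝ F
  exact ⟨E.isSuborbifoldEmbedding_zeroSection, E.vertical, E.isVerticalTangentBundle_vertical,
    E.isGood_vertical, E.verticalRestriction, E.isRestriction_verticalRestriction,
    ⟨E.isoPush _ _⟩⟩
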